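/- **Stability of the fixed points of the mean-field Sznajd model with a confidence rule.** Consider a finite set of opinions and a confidence rule $p_{\sigma\to\tau}\in[0,1]$. Its directed skeleton $\mathcal R$ is the digraph with an arc $\sigma\to\tau$ iff $p_{\sigma\to\tau}\neq 0$. Let $q\ge 2$, $r\ge 1$ be integers, and consider on the standard simplex the flow $$\dot\eta_\sigma=F_\sigma(\eta)=r\sum_{\tau}\eta_\sigma\eta_\tau\bigl(\eta_\sigma^{q-1}p_{\tau\to\sigma}-\eta_\tau^{q-1}p_{\sigma\to\tau}\bigr).$$ Let $\eta^*$ be a fixed point in the simplex, $\Delta=\{\sigma:\eta^*_\sigma>0\}$ the set of surviving opinions, $\overline\Delta$ its complement, $\Delta_-$ (resp. $\Delta_+$) the set of nodes of $\mathcal R$ with an arc to (resp. from) some node of $\Delta$, and $k$ the number of (weakly connected) components of the subgraph of $\mathcal R$ induced by $\Delta$. For a set $\Gamma$ of opinions let $\mathcal M_\Gamma$ be the set of states in which only opinions of $\Gamma$ survive. Let $J^*$ be the Jacobian of $F$ at $\eta^*$, and let $e_\sigma$ be the consensus state of $\sigma$. Directions at $\eta^*$ are counted as follows. Eigenvalues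 are those of $J^*$ on the tangent space $\{v:\sum_\sigma v_\sigma=0\}$, with algebraic multiplicity. An extinct opinion $\sigma\in\overline\Delta$ gives a *degenerate direction* $e_\sigma-\eta^*$ if $J^*(e_\sigma-\eta^*)=0$. A degenerate direction is *repulsive* (resp. *attractive*) if there is a neighbourhood $U$ of $\eta^*$ such that, on each trajectory in $\mathcal M_{\Delta\cup\{\sigma\}}$ starting with $\eta_\sigma>0$, the coordinate $\eta_\sigma$ strictly increases (resp. decreases) as long as the trajectory stays in $U$, and the trajectory cannot stay in $U$ forever (resp. if it stays in $U$ forever, then $\eta_\sigma\to0$). The number of unstable (resp. stable) directions is the number of eigenvalues with positive (resp. negative) real part plus the number of repulsive (resp. attractive) degenerate directions; the neutral directions are the degenerate directions that are neither attractive nor repulsive; and the number of directions with no movement is the dimension of the space of all $v$ such that $\eta^*+tv$ is a fixed point in the simplex for all $t$ (of both signs) close to $0$. Then: 1. there are $|\Delta|+|(\overline\Delta-\Delta_-)\cap\Delta_+|-k$ unstable directions; 2. there are $|\overline\Delta\cap\Delta_-|$ stable directions; 3. there are $k-1$ directions with no movement; 4. there are $|(\overline\Delta-\Delta_-)\cap(\overline\Delta-\Delta_+)|$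 neutral directions. Along the one given by $\sigma$ there is movement, that is, $F_\sigma\ne0$ at states of the simplex arbitrarily close to $\eta^*$, if and only if $\sigma$ is joined to at least one other opinion in $\mathcal R$; 5. put $\lambda_\sigma=-r\sum_{\tau\in\Delta}\eta_\tau^{*q}p_{\sigma\to\tau}$ for $\sigma\in\overline\Delta$, $\omega=\{\sigma\in\overline\Delta:\lambda_\sigma=0\}$, $\Lambda=\max_{\sigma\in\overline\Delta-\omega}\lambda_\sigma$ and $\eta_\omega=\sum_{\sigma\in\omega}\eta_\sigma$. If every $\sigma\in\overline\Delta$ satisfies $\lambda_\sigma<0$ or $\sigma\notin\Delta_+$, then there is a neighbourhood $U$ of $\eta^*$ such that every trajectory in the simplex that stays in $U$ during $[0,T]$ satisfies $$\eta_\omega(0)\,e^{|\overline\Delta-\omega|r/(q\Lambda)}\le\eta_\omega(T)\le\eta_\omega(0)\,e^{-|\overline\Delta-\omega|r/\Lambda}$$ (both exponents being $0$ if $\overline\Delta=\omega$); 6. hence the stability of the fixed point depends only on $\Delta$ and $\mathcal R$: for any other rule, $q'\ge2$, $r'\ge1$ and fixed point with the same skeleton and the same surviving opinions, the numbers of unstable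 and stable directions and of directions with no movement are the same, and so are the neutral directions. -/

import Mathlib

open Set Filter Topology

/-- A confidence rule on the set `ι` of opinions: `p σ τ` is the probability `p_{σ → τ}` that an
agent of opinion `σ` is convinced by a group of agents of opinion `τ`. -/
structure ConfidenceRule (ι : Type*) where
  p : ι → ι → ℝ
  nonneg : ∀ σ τ, 0 ≤ p σ τ
  le_one : ∀ σ τ, p σ τ ≤ 1

/-- The opinions that survive at `η`. -/
noncomputable def survivors {ι : Type*} [Fintype ι] (η : ι → ℝ) : Finset ι :=
  Finset.univ.filter fun σ => 0 < η σ

open Classical in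
/-- The set `Δ₋` of nodes pointing to some node of `Δ`. -/
noncomputable def predecessors {ι : Type*} [Fintype ι] (S : Digraph ι) (Δ : Finset ι) :
    Finset ι :=
  Finset.univ.filter fun σ => ∃ τ ∈ Δ, S.Adj σ τ

open Classical in
/-- The set `Δ₊` of nodes pointed to by some node of `Δ`. -/
noncomputable def successors {ι : Type*} [Fintype ι] (S : Digraph ι) (Δ : Finset ι) :
    Finset ι :=
  Finset.univ.filter fun σ => ∃ τ ∈ Δ, S.Adj τ σ

/-- The number of components of the digraph induced on `Δ` (a component is a maximal part that is
not a disjoint union of smaller parts, so the directions of the arcs play no role). -/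
noncomputable def numComponents {ι : Type*} (S : Digraph ι) (Δ : Finset ι) : ℕ :=
  Nat.card ((SimpleGraph.fromRel S.Adj).induce (Δ : Set ι)).ConnectedComponent

/-- The node `σ` is joined to no other node. -/
def IsIsolatedNode {ι : Type*} (S : Digraph ι) (σ : ι) : Prop :=
  ∀ τ, τ ≠ σ → ¬ S.Adj σ τ ∧ ¬ S.Adj τ σ

/-- The manifold `M_Δ` of states in which only opinions of `Δ` survive. -/
def onlySurviving {ι : Type*} [Fintype ι] (Δ : Finset ι) : Set (ι → ℝ) :=
  {η | η ∈ stdSimplex ℝ ι ∧ ∑ σ ∈ Δ, η σ = 1}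

/-- The vectors parallel to the phase space. -/
def tangentSpace (ι : Type*) [Fintype ι] : Submodule ℝ (ι → ℝ) where
  carrier := {v | ∑ σ, v σ = 0}
  add_mem' := by
    intro a b ha hb
    simp only [Set.mem_ofPred_eq, Pi.add_apply, Finset.sum_add_distrib] at *
    rw [ha, hb, add_zero]
  zero_mem' := by simp
  smul_mem' := by
    intro c a ha
    simp only [Set.mem_ofPred_eq, Pi.smul_apply, smul_eq_mul, ← Finset.mul_sum] at *
    rw [ha, mul_zero]

namespace ConfidenceRule

variable {ι : Type*}

/-- The directed skeleton of the rule. -/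
def skeleton (R : ConfidenceRule ι) : Digraph ι where
  Adj σ τ := R.p σ τ ≠ 0

variable [Fintype ι]

/-- The mean-field vector field `F`. -/
def meanField (R : ConfidenceRule ι) (q r : ℕ) (η : ι → ℝ) : ι → ℝ := fun σ =>
  (r : ℝ) * ∑ τ, η σ * η τ * (η σ ^ (q - 1) * R.p τ σ - η τ ^ (q - 1) * R.p σ τ)

/-- A fixed point of the mean-field flow in the phase space, the standard simplex. -/
def IsFixedPoint (R : ConfidenceRule ι) (q r : ℕ) (η : ι → ℝ) : Prop :=
  η ∈ stdSimplex ℝ ι ∧ R.meanField q r η = 0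

/-- `x` restricted to `[0, T]` is a trajectory of the mean-field flow that stays in `A`. -/
def IsTrajectoryIn (R : ConfidenceRule ι) (q r : ℕ) (A : Set (ι → ℝ)) (T : ℝ)
    (x : ℝ → ι → ℝ) : Prop :=
  ∀ t ∈ Icc (0 : ℝ) T, x t ∈ A ∧ HasDerivWithinAt x (R.meanField q r (x t)) (Icc 0 T) t

theorem differentiable_meanField (R : ConfidenceRule ι) (q r : ℕ) :
    Differentiable ℝ (R.meanField q r) := by
  unfold meanField
  fun_prop

theorem sum_meanField (R : ConfidenceRule ι) (q r : ℕ) (η : ι → ℝ) :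
    ∑ σ, R.meanField q r η σ = 0 := by
  have h : ∑ σ, ∑ τ, η σ * η τ * (η σ ^ (q - 1) * R.p τ σ - η τ ^ (q - 1) * R.p σ τ)
      = -∑ σ, ∑ τ, η σ * η τ * (η σ ^ (q - 1) * R.p τ σ - η τ ^ (q - 1) * R.p σ τ) := by
    conv_lhs => rw [Finset.sum_comm]
    simp only [← Finset.sum_neg_distrib]
    refine Finset.sum_congr rfl fun σ _ => Finset.sum_congr rfl fun τ _ => ?_
    ring
  simp only [meanField, ← Finset.mul_sum]
  rw [show ∑ σ, ∑ τ, η σ * η τ * (η σ ^ (q - 1) * R.p τ σ - η τ ^ (q - 1) * R.p σ τ) = 0 by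
    linarith, mul_zero]

/-- The Jacobian of the mean-field vector field at `η`. -/
noncomputable def jacobian (R : ConfidenceRule ι) (q r : ℕ) (η : ι → ℝ) :
    (ι → ℝ) →ₗ[ℝ] (ι → ℝ) :=
  (fderiv ℝ (R.meanField q r) η).toLinearMap

theorem jacobian_mem_tangentSpace (R : ConfidenceRule ι) (q r : ℕ) (η : ι → ℝ) :
    ∀ v ∈ tangentSpace ι, R.jacobian q r η v ∈ tangentSpace ι := by
  intro v _
  have hF := (R.differentiable_meanField q r η).hasFDerivAt
  have h1 : HasFDerivAt (fun x => ∑ σ, R.meanField q r x σ)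
      (∑ σ, (ContinuousLinearMap.proj σ).comp (fderiv ℝ (R.meanField q r) η)) η :=
    HasFDerivAt.fun_sum fun σ _ => (hasFDerivAt_pi'.1 hF σ)
  have h2 : HasFDerivAt (fun x => ∑ σ, R.meanField q r x σ) (0 : (ι → ℝ) →L[ℝ] ℝ) η := by
    simp only [sum_meanField]
    exact hasFDerivAt_const _ _
  have h3 := congrArg (fun L => L v) (h1.unique h2)
  simpa [tangentSpace, jacobian] using h3

/-- The Jacobian at `η` as an endomorphism of the space of vectors parallel to the phase space. -/
noncomputable def tangentJacobian (R : ConfidenceRule ι) (q r : ℕ) (η : ι → ℝ) :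
    tangentSpace ι →ₗ[ℝ] tangentSpace ι :=
  (R.jacobian q r η).restrict (R.jacobian_mem_tangentSpace q r η)

/-- The complex eigenvalues of the Jacobian on the tangent space, with algebraic multiplicity. -/
noncomputable def eigenvalues (R : ConfidenceRule ι) (q r : ℕ) (η : ι → ℝ) : Multiset ℂ :=
  ((R.tangentJacobian q r η).charpoly.map (algebraMap ℝ ℂ)).roots

/-- The number of directions with no movement: the dimension of the space of the vectors `v` such
that the points `η + t v`, for small `t` of both signs, are all fixed points in the phase space. -/
noncomputable def noMovementDirections (R : ConfidenceRule ι) (q r : ℕ) (η : ι → ℝ) : ℕ :=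
  Module.finrank ℝ (Submodule.span ℝ
    {v : ι → ℝ | ∀ᶠ t : ℝ in 𝓝 0, R.IsFixedPoint q r (η + t • v)})

/-- There is movement in the coordinate `σ` at states arbitrarily close to `η`. -/
def HasMovementAlong (R : ConfidenceRule ι) (q r : ℕ) (η : ι → ℝ) (σ : ι) : Prop :=
  ∃ᶠ ν in 𝓝[stdSimplex ℝ ι] η, R.meanField q r ν σ ≠ 0

/-- The rate `λ_σ` at which the extinct opinion `σ` decays, to first order, near `η`. -/
noncomputable def decayEigenvalue (R : ConfidenceRule ι) (q r : ℕ) (η : ι → ℝ) (σ : ι) : ℝ :=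
  -((r : ℝ) * ∑ τ ∈ survivors η, η τ ^ q * R.p σ τ)

variable [DecidableEq ι]

/-- The opinion `σ` is extinct at `η`, and the direction from `η` towards the consensus state of
`σ` is an eigenvector of eigenvalue `0` of the Jacobian: the linear part of the flow does not
decide whether trajectories are attracted or repelled in this direction. -/
def IsDegenerateAlong (R : ConfidenceRule ι) (q r : ℕ) (η : ι → ℝ) (σ : ι) : Prop :=
  σ ∉ survivors η ∧ R.jacobian q r η (Pi.single σ 1 - η) = 0

/-- Near `η`, the trajectories on which only `σ` is added to the surviving opinions are attracted
to the manifold where `σ` is extinct: the proportion of `σ` strictly decreases as long as the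
trajectory remains near `η`, and tends to `0` if it remains there forever. -/
def IsAttractiveAlong (R : ConfidenceRule ι) (q r : ℕ) (η : ι → ℝ) (σ : ι) : Prop :=
  ∃ U ∈ 𝓝 η, ∀ x : ℝ → ι → ℝ, 0 < x 0 σ →
    (∀ T > 0, R.IsTrajectoryIn q r (U ∩ onlySurviving (insert σ (survivors η))) T x →
      x T σ < x 0 σ) ∧
    ((∀ T > 0, R.IsTrajectoryIn q r (U ∩ onlySurviving (insert σ (survivors η))) T x) →
      Tendsto (fun t => x t σ) atTop (𝓝 0))

/-- Near `η`, the trajectories on which only `σ` is added to the surviving opinions are repelled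
from the manifold where `σ` is extinct: the proportion of `σ` strictly increases as long as the
trajectory remains near `η`, and the trajectory does not remain there forever. -/
def IsRepulsiveAlong (R : ConfidenceRule ι) (q r : ℕ) (η : ι → ℝ) (σ : ι) : Prop :=
  ∃ U ∈ 𝓝 η, ∀ x : ℝ → ι → ℝ, 0 < x 0 σ →
    (∀ T > 0, R.IsTrajectoryIn q r (U ∩ onlySurviving (insert σ (survivors η))) T x →
      x 0 σ < x T σ) ∧
    ¬ ∀ T > 0, R.IsTrajectoryIn q r (U ∩ onlySurviving (insert σ (survivors η))) T x

open Classical in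
/-- The number of unstable directions: the eigenvalues with positive real part, and the degenerate
directions in which the higher order terms are repulsive. -/
noncomputable def unstableDirections (R : ConfidenceRule ι) (q r : ℕ) (η : ι → ℝ) : ℕ :=
  (R.eigenvalues q r η).countP (fun z => 0 < z.re) +
    (Finset.univ.filter fun σ =>
      R.IsDegenerateAlong q r η σ ∧ R.IsRepulsiveAlong q r η σ).card

open Classical in
/-- The number of stable directions: the eigenvalues with negative real part, and the degenerate
directions in which the higher order terms are attractive. -/
noncomputable def stableDirections (R : ConfidenceRule ι) (q r : ℕ) (η : ι → ℝ) : ℕ :=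
  (R.eigenvalues q r η).countP (fun z => z.re < 0) +
    (Finset.univ.filter fun σ =>
      R.IsDegenerateAlong q r η σ ∧ R.IsAttractiveAlong q r η σ).card

open Classical in
/-- The degenerate directions that are neither attractive nor repulsive. -/
noncomputable def neutralDirections (R : ConfidenceRule ι) (q r : ℕ) (η : ι → ℝ) : Finset ι :=
  Finset.univ.filter fun σ => R.IsDegenerateAlong q r η σ ∧
    ¬ R.IsAttractiveAlong q r η σ ∧ ¬ R.IsRepulsiveAlong q r η σ

/-- The extinct opinions `σ` with `λ_σ = 0`. -/
noncomputable def nullExtinct (R : ConfidenceRule ι) (q r : ℕ) (η : ι → ℝ) : Finset ι :=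
  (survivors η)ᶜ.filter fun σ => R.decayEigenvalue q r η σ = 0

/-- The largest of the nonzero `λ_σ` over the extinct opinions. -/
noncomputable def maxDecay (R : ConfidenceRule ι) (q r : ℕ) (η : ι → ℝ) : ℝ :=
  sSup (R.decayEigenvalue q r η '' ((survivors η)ᶜ \ R.nullExtinct q r η : Finset ι))

end ConfidenceRule

/-!
At a fixed point `η` the fluxes `η σ * η τ ^ q * p σ τ` between opinions form a circulation: the
inflow and the outflow of each opinion agree (`IsFixedPoint.sum_flux`). In the variables
`w = v / η`, the Jacobian at the surviving opinions is therefore `q` times the Laplacian weighted by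
the outgoing fluxes minus the Laplacian weighted by the incoming ones. As the two Laplacians of a
circulation have the same quadratic form, that of the Jacobian is `q - 1` times a Dirichlet form
(`IsFixedPoint.sum_mul_jacobian_mul_self`). Hence the block at the surviving opinions has `k` zero
eigenvalues, given by the functions constant on components, which are also orthogonal to its range,
so that `0` is semisimple; all its other eigenvalues have positive real part.

The rows of the Jacobian at extinct opinions are diagonal since `q ≥ 2`, with entries the decay
rates `λ σ ≤ 0`, which vanish exactly off `Δ₋`. So the characteristic polynomial factors, and
restricting to the tangent space removes one zero eigenvalue (`IsFixedPoint.zero_cons_eigenvalues`).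

An extinct opinion `σ` gives a degenerate direction iff it has no arc to `Δ`. If it has an arc from
`Δ`, its proportion grows at least linearly, so the direction is repulsive, and it is not
attractive because trajectories along it exist for a short time, by the Picard-Lindelöf theorem.
If it has none, then mixing `σ` into `η` gives fixed points, so the direction is neutral. The
directions with no movement are the rescalings of the components that preserve the total mass.

Finally, the total proportion `N` of the opinions with vanishing decay rate changes only by
exchanges with the decaying opinions, whose total proportion `a` satisfies `a' ≤ (Λ / 2) a` near
`η`. Then `N exp (c a)` is decreasing and `N exp (-c' a)` is increasing for suitable constants,
which bounds `N` on both sides (`exists_nhds_nullExtinct_bounds`).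
-/

/-! ### Fluxes between opinions -/

theorem mem_survivors {ι : Type*} [Fintype ι] {η : ι → ℝ} {σ : ι} :
    σ ∈ survivors η ↔ 0 < η σ := by
  simp [survivors]

theorem eq_zero_of_notMem_survivors {ι : Type*} [Fintype ι] {η : ι → ℝ}
    (hη : η ∈ stdSimplex ℝ ι) {σ : ι} (hσ : σ ∉ survivors η) : η σ = 0 :=
  le_antisymm (not_lt.1 fun h => hσ (mem_survivors.2 h)) (hη.1 σ)

theorem sum_survivors {ι : Type*} [Fintype ι] {η : ι → ℝ} (hη : η ∈ stdSimplex ℝ ι) :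
    ∑ σ ∈ survivors η, η σ = 1 := by
  rw [← hη.2]
  exact Finset.sum_subset (Finset.subset_univ _) fun σ _ hσ => eq_zero_of_notMem_survivors hη hσ

namespace ConfidenceRule

variable {ι : Type*}

/-- The rate, up to the factor `r`, at which agents of opinion `σ` adopt the opinion `τ` in the
state `η`. -/
def flux (R : ConfidenceRule ι) (q : ℕ) (η : ι → ℝ) (σ τ : ι) : ℝ :=
  η σ * η τ ^ q * R.p σ τ

theorem flux_nonneg {R : ConfidenceRule ι} {q : ℕ} {η : ι → ℝ} (hη : ∀ σ, 0 ≤ η σ) (σ τ : ι) :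
    0 ≤ R.flux q η σ τ :=
  mul_nonneg (mul_nonneg (hη σ) (pow_nonneg (hη τ) q)) (R.nonneg σ τ)

variable [Fintype ι] {R : ConfidenceRule ι} {q r : ℕ} {η : ι → ℝ}

theorem flux_ne_zero_iff (hη : η ∈ stdSimplex ℝ ι) (hq : 1 ≤ q) {σ τ : ι} :
    R.flux q η σ τ ≠ 0 ↔ σ ∈ survivors η ∧ τ ∈ survivors η ∧ R.skeleton.Adj σ τ := by
  have h (σ) : σ ∈ survivors η ↔ η σ ≠ 0 :=
    mem_survivors.trans ⟨ne_of_gt, fun h => lt_of_le_of_ne (hη.1 σ) h.symm⟩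
  simp only [flux, mul_ne_zero_iff, h, skeleton, and_assoc,
    pow_ne_zero_iff (show q ≠ 0 by lia)]

theorem meanField_eq_flux (hq : 1 ≤ q) (η : ι → ℝ) (σ : ι) :
    R.meanField q r η σ = r * ∑ τ, (R.flux q η τ σ - R.flux q η σ τ) := by
  obtain ⟨m, rfl⟩ : ∃ m, q = m + 1 := ⟨q - 1, by lia⟩
  simp only [meanField, flux, add_tsub_cancel_right]
  congr 1
  refine Finset.sum_congr rfl fun τ _ => ?_
  ring

/-- At a fixed point the fluxes form a circulation. -/
theorem IsFixedPoint.sum_flux (h : R.IsFixedPoint q r η) (hq : 1 ≤ q) (hr : 1 ≤ r) (σ : ι) :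
    ∑ τ, R.flux q η τ σ = ∑ τ, R.flux q η σ τ := by
  have h1 := congrFun h.2 σ
  rw [meanField_eq_flux hq, Pi.zero_apply, Finset.sum_sub_distrib, mul_eq_zero] at h1
  have : (r : ℝ) ≠ 0 := by positivity
  simpa [this, sub_eq_zero] using h1

/-! ### The Jacobian -/

theorem jacobian_apply (hq : 1 ≤ q) (η v : ι → ℝ) (σ : ι) :
    R.jacobian q r η v σ = r * ∑ τ,
      ((v τ * η σ ^ q + η τ * (q * η σ ^ (q - 1) * v σ)) * R.p τ σ -
        (v σ * η τ ^ q + η σ * (q * η τ ^ (q - 1) * v τ)) * R.p σ τ) := by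
  have hline (ρ : ι) : HasDerivAt (fun t : ℝ => (η + t • v) ρ) (v ρ) 0 := by
    simpa using ((hasDerivAt_id (0 : ℝ)).mul_const (v ρ)).const_add (η ρ)
  have hflux (ρ τ : ι) : HasDerivAt (fun t : ℝ => R.flux q (η + t • v) ρ τ)
      ((v ρ * η τ ^ q + η ρ * (q * η τ ^ (q - 1) * v τ)) * R.p ρ τ) 0 := by
    simpa [flux] using ((hline ρ).mul ((hline τ).pow q)).mul_const (R.p ρ τ)
  have h1 : HasDerivAt (fun t : ℝ => R.meanField q r (η + t • v) σ) (r * ∑ τ,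
      ((v τ * η σ ^ q + η τ * (q * η σ ^ (q - 1) * v σ)) * R.p τ σ -
        (v σ * η τ ^ q + η σ * (q * η τ ^ (q - 1) * v τ)) * R.p σ τ)) 0 := by
    simp only [meanField_eq_flux hq]
    exact (HasDerivAt.fun_sum fun τ _ => (hflux τ σ).sub (hflux σ τ)).const_mul _
  have hF := (R.differentiable_meanField q r (η + (0 : ℝ) • v)).hasFDerivAt
  have h2 := hasDerivAt_pi.1 (hF.comp_hasDerivAt (0 : ℝ)
    (hasDerivAt_pi.2 hline : HasDerivAt (fun t : ℝ => η + t • v) v 0)) σ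
  have := h2.unique h1
  simpa [jacobian] using this

/-- For `v = η w` the Jacobian at a fixed point is a difference of two graph Laplacians, weighted
by the outgoing and the incoming fluxes. -/
theorem IsFixedPoint.jacobian_mul (h : R.IsFixedPoint q r η) (hq : 1 ≤ q) (hr : 1 ≤ r)
    (w : ι → ℝ) (σ : ι) :
    R.jacobian q r η (η * w) σ = r * ∑ τ,
      (q * (R.flux q η σ τ * (w σ - w τ)) - R.flux q η τ σ * (w σ - w τ)) := by
  rw [jacobian_apply hq]
  congr 1
  have hb := h.sum_flux hq hr σ
  obtain ⟨m, rfl⟩ : ∃ m, q = m + 1 := ⟨q - 1, by lia⟩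
  rw [← sub_eq_zero, ← Finset.sum_sub_distrib]
  have h2 : (((m + 1 : ℕ) : ℝ) + 1) * w σ *
      (∑ τ, R.flux (m + 1) η τ σ - ∑ τ, R.flux (m + 1) η σ τ) = 0 := by rw [hb]; ring
  rw [← Finset.sum_sub_distrib, Finset.mul_sum] at h2
  rw [← h2]
  refine Finset.sum_congr rfl fun τ _ => ?_
  simp only [flux, Pi.mul_apply, add_tsub_cancel_right]
  push_cast
  ring

/-- The quadratic form of the Jacobian, in the variables `w = v / η`, is a weighted Dirichlet form:
the sum of the two Laplacian forms of a circulation. -/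
theorem IsFixedPoint.sum_mul_jacobian_mul_self (h : R.IsFixedPoint q r η) (hq : 1 ≤ q)
    (hr : 1 ≤ r) (w : ι → ℝ) :
    ∑ σ, w σ * R.jacobian q r η (η * w) σ =
      r * (q - 1) / 2 * ∑ σ, ∑ τ, R.flux q η σ τ * (w σ - w τ) ^ 2 := by
  have e1 : ∑ σ, ∑ τ, w σ ^ 2 * R.flux q η τ σ = ∑ σ, ∑ τ, w σ ^ 2 * R.flux q η σ τ := by
    simp only [← Finset.mul_sum, h.sum_flux hq hr]
  have e2 : ∑ σ, ∑ τ, w σ ^ 2 * R.flux q η τ σ = ∑ σ, ∑ τ, w τ ^ 2 * R.flux q η σ τ :=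
    Finset.sum_comm
  have e3 : ∑ σ, ∑ τ, w σ * w τ * R.flux q η τ σ = ∑ σ, ∑ τ, w σ * w τ * R.flux q η σ τ := by
    rw [Finset.sum_comm]
    simp only [mul_comm]
  have l : ∑ σ, w σ * R.jacobian q r η (η * w) σ =
      r * (q * (∑ σ, ∑ τ, w σ ^ 2 * R.flux q η σ τ - ∑ σ, ∑ τ, w σ * w τ * R.flux q η σ τ) -
        (∑ σ, ∑ τ, w σ ^ 2 * R.flux q η τ σ - ∑ σ, ∑ τ, w σ * w τ * R.flux q η τ σ)) := by
    simp only [h.jacobian_mul hq hr, ← Finset.sum_sub_distrib, Finset.mul_sum]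
    refine Finset.sum_congr rfl fun σ _ => Finset.sum_congr rfl fun τ _ => ?_
    ring
  have rr : ∑ σ, ∑ τ, R.flux q η σ τ * (w σ - w τ) ^ 2 =
      (∑ σ, ∑ τ, w σ ^ 2 * R.flux q η σ τ) - 2 * (∑ σ, ∑ τ, w σ * w τ * R.flux q η σ τ) +
        ∑ σ, ∑ τ, w τ ^ 2 * R.flux q η σ τ := by
    simp only [Finset.mul_sum, ← Finset.sum_sub_distrib, ← Finset.sum_add_distrib]
    refine Finset.sum_congr rfl fun σ _ => Finset.sum_congr rfl fun τ _ => ?_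
    ring
  rw [l, rr, ← e2, e3, e1]
  ring

/-- The function `w` takes the same value at the two ends of each arc of the skeleton between
surviving opinions, that is, it is constant on each component of the surviving opinions. -/
def IsComponentwiseConst (R : ConfidenceRule ι) (η w : ι → ℝ) : Prop :=
  ∀ σ ∈ survivors η, ∀ τ ∈ survivors η, R.skeleton.Adj σ τ → w σ = w τ

theorem flux_mul_sub_eq_zero (hη : η ∈ stdSimplex ℝ ι) (hq : 1 ≤ q) {w : ι → ℝ}
    (hw : R.IsComponentwiseConst η w) (σ τ : ι) : R.flux q η σ τ * (w σ - w τ) = 0 := by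
  by_cases h : R.flux q η σ τ = 0
  · rw [h, zero_mul]
  · obtain ⟨h1, h2, h3⟩ := (flux_ne_zero_iff hη hq).1 h
    rw [hw σ h1 τ h2 h3, sub_self, mul_zero]

theorem IsFixedPoint.jacobian_mul_eq_zero (h : R.IsFixedPoint q r η) (hq : 1 ≤ q) (hr : 1 ≤ r)
    {w : ι → ℝ} (hw : R.IsComponentwiseConst η w) : R.jacobian q r η (η * w) = 0 := by
  ext σ
  rw [h.jacobian_mul hq hr, Pi.zero_apply, Finset.sum_eq_zero, mul_zero]
  intro τ _
  have h1 := flux_mul_sub_eq_zero (q := q) h.1 hq hw σ τ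
  have h2 := flux_mul_sub_eq_zero (q := q) h.1 hq hw τ σ
  linear_combination q * h1 + h2

/-- The vector field is homogeneous, so the Jacobian at a fixed point kills its position vector. -/
theorem IsFixedPoint.jacobian_self (h : R.IsFixedPoint q r η) (hq : 1 ≤ q) (hr : 1 ≤ r) :
    R.jacobian q r η η = 0 := by
  simpa using h.jacobian_mul_eq_zero hq hr (w := 1) fun _ _ _ _ _ => rfl

theorem IsFixedPoint.sum_mul_jacobian_mul_nonneg (h : R.IsFixedPoint q r η) (hq : 1 ≤ q)
    (hr : 1 ≤ r) (w : ι → ℝ) : 0 ≤ ∑ σ, w σ * R.jacobian q r η (η * w) σ := by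
  rw [h.sum_mul_jacobian_mul_self hq hr]
  have : (0 : ℝ) ≤ q - 1 := by
    have : (1 : ℝ) ≤ q := by exact_mod_cast hq
    linarith
  exact mul_nonneg (by positivity) (Finset.sum_nonneg fun σ _ => Finset.sum_nonneg fun τ _ =>
    mul_nonneg (flux_nonneg h.1.1 σ τ) (sq_nonneg _))

theorem IsFixedPoint.isComponentwiseConst_of_sum_eq_zero (h : R.IsFixedPoint q r η) (hq : 2 ≤ q)
    (hr : 1 ≤ r) {w : ι → ℝ} (hw : ∑ σ, w σ * R.jacobian q r η (η * w) σ = 0) :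
    R.IsComponentwiseConst η w := by
  have hq1 : 1 ≤ q := by lia
  have h2 : (2 : ℝ) ≤ q := by exact_mod_cast hq
  have h3 : (1 : ℝ) ≤ r := by exact_mod_cast hr
  have hpos : (r : ℝ) * (q - 1) / 2 ≠ 0 := by
    have : (0 : ℝ) < q - 1 := by linarith
    positivity
  rw [h.sum_mul_jacobian_mul_self hq1 hr, mul_eq_zero, or_iff_right hpos] at hw
  have hnn (σ τ : ι) : 0 ≤ R.flux q η σ τ * (w σ - w τ) ^ 2 :=
    mul_nonneg (flux_nonneg h.1.1 σ τ) (sq_nonneg _)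
  intro σ hσ τ hτ hadj
  rw [Finset.sum_eq_zero_iff_of_nonneg fun σ _ => Finset.sum_nonneg fun τ _ => hnn σ τ] at hw
  have h4 := hw σ (Finset.mem_univ σ)
  rw [Finset.sum_eq_zero_iff_of_nonneg fun τ _ => hnn σ τ] at h4
  have h5 := h4 τ (Finset.mem_univ τ)
  rw [mul_eq_zero, or_iff_right ((flux_ne_zero_iff h.1 hq1).2 ⟨hσ, hτ, hadj⟩)] at h5
  exact sub_eq_zero.1 (pow_eq_zero_iff (two_ne_zero)|>.1 h5)

theorem IsFixedPoint.jacobian_mul_eq_zero_iff (h : R.IsFixedPoint q r η) (hq : 2 ≤ q)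
    (hr : 1 ≤ r) {w : ι → ℝ} :
    R.jacobian q r η (η * w) = 0 ↔ R.IsComponentwiseConst η w :=
  ⟨fun h0 => h.isComponentwiseConst_of_sum_eq_zero hq hr (by simp [h0]),
    h.jacobian_mul_eq_zero (by lia) hr⟩

/-- The range of the Jacobian is orthogonal to the functions that are constant on components. -/
theorem IsFixedPoint.sum_mul_jacobian_mul_eq_zero (h : R.IsFixedPoint q r η) (hq : 1 ≤ q)
    (hr : 1 ≤ r) {u : ι → ℝ} (hu : R.IsComponentwiseConst η u) (w : ι → ℝ) :
    ∑ σ, u σ * R.jacobian q r η (η * w) σ = 0 := by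
  have hc (σ τ : ι) : R.flux q η σ τ * u σ = R.flux q η σ τ * u τ := by
    linear_combination flux_mul_sub_eq_zero (q := q) h.1 hq hu σ τ
  have e1 : ∑ σ, ∑ τ, (u σ * w σ) * R.flux q η τ σ = ∑ σ, ∑ τ, (u σ * w σ) * R.flux q η σ τ := by
    simp only [← Finset.mul_sum, h.sum_flux hq hr]
  have e2 : ∑ σ, ∑ τ, (u σ * w σ) * R.flux q η τ σ = ∑ σ, ∑ τ, u σ * w τ * R.flux q η σ τ := by
    rw [Finset.sum_comm]
    refine Finset.sum_congr rfl fun σ _ => Finset.sum_congr rfl fun τ _ => ?_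
    linear_combination - w τ * hc σ τ
  have e3 : ∑ σ, ∑ τ, u σ * w τ * R.flux q η τ σ = ∑ σ, ∑ τ, (u σ * w σ) * R.flux q η σ τ := by
    rw [Finset.sum_comm]
    refine Finset.sum_congr rfl fun σ _ => Finset.sum_congr rfl fun τ _ => ?_
    linear_combination - w σ * hc σ τ
  have l : ∑ σ, u σ * R.jacobian q r η (η * w) σ =
      r * (q * (∑ σ, ∑ τ, (u σ * w σ) * R.flux q η σ τ - ∑ σ, ∑ τ, u σ * w τ * R.flux q η σ τ) -
        (∑ σ, ∑ τ, (u σ * w σ) * R.flux q η τ σ - ∑ σ, ∑ τ, u σ * w τ * R.flux q η τ σ)) := by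
    simp only [h.jacobian_mul hq hr, ← Finset.sum_sub_distrib, Finset.mul_sum]
    refine Finset.sum_congr rfl fun σ _ => Finset.sum_congr rfl fun τ _ => ?_
    ring
  rw [l, ← e2, e3, e1]
  ring

/-- Rescaling each component of the surviving opinions preserves the balance of the fluxes. -/
theorem IsFixedPoint.meanField_mul_eq_zero (h : R.IsFixedPoint q r η) (hq : 1 ≤ q) (hr : 1 ≤ r)
    {u : ι → ℝ} (hu : R.IsComponentwiseConst η u) : R.meanField q r (η * u) = 0 := by
  ext σ
  have hfl (σ τ : ι) : R.flux q (η * u) σ τ = u σ * u τ ^ q * R.flux q η σ τ := by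
    simp only [flux, Pi.mul_apply]
    ring
  have hsc (σ τ : ι) (k : ℕ) : u σ ^ k * R.flux q η σ τ = u τ ^ k * R.flux q η σ τ := by
    by_cases h0 : R.flux q η σ τ = 0
    · rw [h0, mul_zero, mul_zero]
    · obtain ⟨h1, h2, h3⟩ := (flux_ne_zero_iff h.1 hq).1 h0
      rw [hu σ h1 τ h2 h3]
  have hb : u σ ^ (q + 1) * (∑ τ, R.flux q η τ σ - ∑ τ, R.flux q η σ τ) = 0 := by
    rw [h.sum_flux hq hr, sub_self, mul_zero]
  rw [meanField_eq_flux hq, Pi.zero_apply]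
  rw [← Finset.sum_sub_distrib, Finset.mul_sum] at hb
  refine mul_eq_zero_of_right _ (Eq.trans (Finset.sum_congr rfl fun τ _ => ?_) hb)
  rw [hfl, hfl]
  linear_combination u σ ^ q * hsc τ σ 1 + u σ * hsc σ τ q

theorem mul_div_eq_of_support {v : ι → ℝ}
    (hv : ∀ σ ∉ survivors η, v σ = 0) : η * (v / η) = v := by
  ext σ
  by_cases hσ : σ ∈ survivors η
  · have := (mem_survivors.1 hσ).ne'
    simp only [Pi.mul_apply, Pi.div_apply]
    field_simp
  · simp [hv σ hσ]

/-- The rows of the Jacobian at extinct opinions are diagonal. -/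
theorem jacobian_apply_of_notMem (hη : η ∈ stdSimplex ℝ ι) (hq : 2 ≤ q) {σ : ι}
    (hσ : σ ∉ survivors η) (v : ι → ℝ) :
    R.jacobian q r η v σ = R.decayEigenvalue q r η σ * v σ := by
  obtain ⟨m, rfl⟩ : ∃ m, q = m + 2 := ⟨q - 2, by lia⟩
  have h0 := eq_zero_of_notMem_survivors hη hσ
  rw [jacobian_apply (by lia), decayEigenvalue]
  have : ∑ τ ∈ survivors η, η τ ^ (m + 2) * R.p σ τ = ∑ τ, η τ ^ (m + 2) * R.p σ τ :=
    Finset.sum_subset (Finset.subset_univ _) fun τ _ hτ => by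
      simp [eq_zero_of_notMem_survivors hη hτ]
  rw [this, ← mul_neg, mul_assoc (r : ℝ), ← Finset.sum_neg_distrib, Finset.sum_mul]
  congr 1
  refine Finset.sum_congr rfl fun τ _ => ?_
  simp only [h0, show m + 2 - 1 = m + 1 by lia]
  ring

/-- On vectors supported by the surviving opinions, the Jacobian is semisimple at `0`. -/
theorem IsFixedPoint.jacobian_eq_zero_of_jacobian_jacobian (h : R.IsFixedPoint q r η)
    (hq : 2 ≤ q) (hr : 1 ≤ r) {v : ι → ℝ} (hv : ∀ σ ∉ survivors η, v σ = 0)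
    (h2 : R.jacobian q r η (R.jacobian q r η v) = 0) : R.jacobian q r η v = 0 := by
  set u := R.jacobian q r η v with hu
  have hus : ∀ σ ∉ survivors η, u σ = 0 := fun σ hσ => by
    rw [hu, jacobian_apply_of_notMem h.1 hq hσ, hv σ hσ, mul_zero]
  rw [← mul_div_eq_of_support hus, h.jacobian_mul_eq_zero_iff hq hr] at h2
  have h3 := h.sum_mul_jacobian_mul_eq_zero (by lia) hr h2 (v / η)
  rw [mul_div_eq_of_support hv, ← hu] at h3
  have hnn (σ : ι) : 0 ≤ (u / η) σ * u σ := by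
    rw [Pi.div_apply, div_mul_eq_mul_div]
    exact div_nonneg (mul_self_nonneg _) (h.1.1 σ)
  rw [Finset.sum_eq_zero_iff_of_nonneg fun σ _ => hnn σ] at h3
  ext σ
  by_cases hσ : σ ∈ survivors η
  · simpa [(mem_survivors.1 hσ).ne'] using h3 σ (Finset.mem_univ σ)
  · exact hus σ hσ

end ConfidenceRule

/-! ### The spectrum of the Jacobian -/

open Polynomial in
/-- If the range of `f` is contained in the kernel of a nonzero functional, restricting `f` to that
kernel removes one zero eigenvalue. -/
theorem LinearMap.charpoly_eq_charpoly_restrict_mul_X {V : Type*} [AddCommGroup V] [Module ℝ V]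
    [FiniteDimensional ℝ V] (f : V →ₗ[ℝ] V) (φ : Module.Dual ℝ V) (hφ : φ ≠ 0)
    (W : Submodule ℝ V) (hW : W = LinearMap.ker φ) (hf : ∀ v, f v ∈ W)
    (hr : ∀ v ∈ W, f v ∈ W) :
    f.charpoly = (f.restrict hr).charpoly * X := by
  have hdim : Module.finrank ℝ (V ⧸ W) = 1 := by
    have h1 := Module.Dual.finrank_ker_add_one_of_ne_zero hφ
    have h2 := W.finrank_quotient_add_finrank
    rw [← hW] at h1
    lia
  refine Polynomial.funext fun t => ?_
  have hr' : W ≤ W.comap (algebraMap ℝ (Module.End ℝ V) t - f) := fun v hv => by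
    simpa using W.sub_mem (W.smul_mem t hv) (hr v hv)
  rw [LinearMap.eval_charpoly, LinearMap.det_eq_det_mul_det W _ hr', eval_mul, eval_X,
    LinearMap.eval_charpoly]
  congr 1
  have : W.mapQ W (algebraMap ℝ (Module.End ℝ V) t - f) hr' = t • LinearMap.id := by
    ext v
    simp only [LinearMap.comp_apply, Submodule.mkQ_apply, Submodule.mapQ_apply,
      LinearMap.smul_apply, LinearMap.id_apply, LinearMap.sub_apply, Module.algebraMap_end_apply,
      Submodule.Quotient.mk_sub, (Submodule.Quotient.mk_eq_zero W).2 (hf v), sub_zero,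
      Submodule.Quotient.mk_smul]
  rw [this, LinearMap.det_smul, hdim, LinearMap.det_id, pow_one, mul_one]

/-- A real matrix has an eigenvalue `z` if there are real vectors `a` and `b`, the real and the
imaginary part of an eigenvector, with the following action. -/
theorem Matrix.exists_re_im_of_mem_roots_charpoly {n : Type*} [Fintype n] [DecidableEq n]
    (B : Matrix n n ℝ) {z : ℂ} (hz : z ∈ (B.charpoly.map (algebraMap ℝ ℂ)).roots) :
    ∃ a b : n → ℝ, (a ≠ 0 ∨ b ≠ 0) ∧ B.mulVec a = z.re • a - z.im • b ∧
      B.mulVec b = z.im • a + z.re • b := by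
  have h1 := Polynomial.isRoot_of_mem_roots hz
  rw [← Matrix.charpoly_map, Polynomial.IsRoot.def, Matrix.eval_charpoly,
    ← Matrix.exists_mulVec_eq_zero_iff] at h1
  obtain ⟨v, hv, h⟩ := h1
  rw [Matrix.sub_mulVec, sub_eq_zero] at h
  have hsc : (Matrix.scalar n z).mulVec v = z • v := by
    ext i
    simp [Matrix.scalar_apply, Matrix.mulVec_diagonal]
  rw [hsc] at h
  refine ⟨fun i => (v i).re, fun i => (v i).im, ?_, ?_, ?_⟩
  · by_contra! h0
    exact hv (funext fun i => Complex.ext (congrFun h0.1 i) (congrFun h0.2 i))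
  · ext i
    have := congrArg Complex.re (congrFun h i)
    simp [Matrix.mulVec, dotProduct] at this
    simp [Matrix.mulVec, dotProduct, ← this]
  · ext i
    have := congrArg Complex.im (congrFun h i)
    simp [Matrix.mulVec, dotProduct] at this
    simp [Matrix.mulVec, dotProduct, ← this, add_comm]

open Polynomial in
theorem Matrix.charpoly_eq_mul_of_diagonal_rows {n : Type*} [Fintype n] [DecidableEq n]
    (A : Matrix n n ℝ) (s : Finset n) (d : n → ℝ)
    (hA : ∀ i ∉ s, ∀ j, A i j = if i = j then d i else 0) :
    A.charpoly = (A.toSquareBlockProp (· ∈ s)).charpoly * ∏ i ∈ sᶜ, (X - C (d i)) := by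
  have h1 : A.charpoly = _ := A.charmatrix.twoBlockTriangular_det (· ∈ s) fun i hi j hj => by
    have hij : i ≠ j := fun h => hi (h ▸ hj)
    rw [Matrix.charmatrix_apply_ne _ _ _ hij, hA i hi, if_neg hij, C_0, neg_zero]
  have h2 : A.charmatrix.toSquareBlockProp (· ∈ s) =
      (A.toSquareBlockProp (· ∈ s)).charmatrix := by
    ext i j : 2
    by_cases hij : i = j
    · subst hij
      simp [Matrix.toSquareBlockProp_def]
    · rw [Matrix.charmatrix_apply_ne _ _ _ hij, Matrix.toSquareBlockProp_def, Matrix.of_apply,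
        Matrix.charmatrix_apply_ne _ _ _ fun h => hij (Subtype.ext h)]
      rfl
  have h3 : A.charmatrix.toSquareBlockProp (fun i => i ∉ s) =
      Matrix.diagonal fun i : {i // i ∉ s} => X - C (d i) := by
    ext i j : 2
    by_cases hij : i = j
    · subst hij
      simp [Matrix.toSquareBlockProp_def, hA i i.2]
    · rw [Matrix.diagonal_apply_ne _ hij, Matrix.toSquareBlockProp_def, Matrix.of_apply,
        Matrix.charmatrix_apply_ne _ _ _ fun h => hij (Subtype.ext h), hA i i.2,
        if_neg fun h => hij (Subtype.ext h), C_0, neg_zero]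
  rw [h2, h3, Matrix.det_diagonal] at h1
  rw [h1, Finset.prod_subtype sᶜ (fun i => Finset.mem_compl) fun i => X - C (d i),
    Matrix.charpoly]
  congr!

namespace ConfidenceRule

variable {ι : Type*} [DecidableEq ι]

/-- The vector on all opinions that extends `x` by zero. -/
def extendByZero (s : Finset ι) : (s → ℝ) →ₗ[ℝ] (ι → ℝ) where
  toFun x σ := if h : σ ∈ s then x ⟨σ, h⟩ else 0
  map_add' x y := by ext σ; by_cases h : σ ∈ s <;> simp [h]
  map_smul' c x := by ext σ; by_cases h : σ ∈ s <;> simp [h]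

theorem extendByZero_apply_coe {s : Finset ι} (x : s → ℝ) (σ : s) :
    extendByZero s x σ = x σ := by
  simp [extendByZero]

theorem extendByZero_apply_of_notMem {s : Finset ι} (x : s → ℝ) {σ : ι} (hσ : σ ∉ s) :
    extendByZero s x σ = 0 := by
  simp [extendByZero, hσ]

theorem extendByZero_injective (s : Finset ι) : Function.Injective (extendByZero s) :=
  fun x y h => funext fun σ => by
    rw [← extendByZero_apply_coe x, h, extendByZero_apply_coe]

variable [Fintype ι] {R : ConfidenceRule ι} {q r : ℕ} {η : ι → ℝ}

/-- The block of the Jacobian matrix at the surviving opinions. -/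
noncomputable def survivorBlock (R : ConfidenceRule ι) (q r : ℕ) (η : ι → ℝ) :
    Matrix (survivors η) (survivors η) ℝ :=
  (LinearMap.toMatrix' (R.jacobian q r η)).toSquareBlockProp (· ∈ survivors η)

theorem survivorBlock_mulVec (x : survivors η → ℝ) (σ : survivors η) :
    (R.survivorBlock q r η).mulVec x σ = R.jacobian q r η (extendByZero _ x) σ := by
  conv_rhs => rw [← Matrix.toLin'_toMatrix' (R.jacobian q r η)]
  have hs : ∑ τ ∈ survivors η, LinearMap.toMatrix' (R.jacobian q r η) σ τ * extendByZero _ x τ =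
      ∑ τ, LinearMap.toMatrix' (R.jacobian q r η) σ τ * extendByZero _ x τ :=
    Finset.sum_subset (Finset.subset_univ _) fun τ _ hτ => by
      rw [extendByZero_apply_of_notMem x hτ, mul_zero]
  rw [Matrix.toLin'_apply, Matrix.mulVec, Matrix.mulVec, dotProduct, dotProduct, ← hs,
    ← Finset.sum_coe_sort (survivors η) fun τ =>
      LinearMap.toMatrix' (R.jacobian q r η) σ τ * extendByZero _ x τ]
  refine Finset.sum_congr rfl fun τ _ => ?_
  rw [extendByZero_apply_coe]
  rfl

theorem extendByZero_survivorBlock_mulVec (hη : η ∈ stdSimplex ℝ ι) (hq : 2 ≤ q)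
    (x : survivors η → ℝ) :
    extendByZero _ ((R.survivorBlock q r η).mulVec x) =
      R.jacobian q r η (extendByZero _ x) := by
  ext σ
  by_cases hσ : σ ∈ survivors η
  · rw [extendByZero_apply_coe _ ⟨σ, hσ⟩, survivorBlock_mulVec]
  · rw [extendByZero_apply_of_notMem _ hσ, jacobian_apply_of_notMem hη hq hσ,
      extendByZero_apply_of_notMem _ hσ, mul_zero]

theorem mul_extendByZero_div (x : survivors η → ℝ) :
    η * (extendByZero _ x / η) = extendByZero _ x :=
  mul_div_eq_of_support fun _ hσ => extendByZero_apply_of_notMem x hσ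

open Polynomial in
theorem IsFixedPoint.charpoly_tangentJacobian_mul_X (h : R.IsFixedPoint q r η) (hq : 2 ≤ q)
    (hr : 1 ≤ r) :
    (R.tangentJacobian q r η).charpoly * X =
      (R.survivorBlock q r η).charpoly *
        ∏ σ ∈ (survivors η)ᶜ, (X - C (R.decayEigenvalue q r η σ)) := by
  have hT : tangentSpace ι = LinearMap.ker (∑ σ, LinearMap.proj σ : (ι → ℝ) →ₗ[ℝ] ℝ) := by
    ext v
    simp only [LinearMap.mem_ker, LinearMap.sum_apply, LinearMap.proj_apply]
    rfl
  have hne : (∑ σ, LinearMap.proj σ : (ι → ℝ) →ₗ[ℝ] ℝ) ≠ 0 := fun h' => by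
    have h1 := LinearMap.congr_fun h' η
    simp only [LinearMap.sum_apply, LinearMap.proj_apply, h.1.2, LinearMap.zero_apply] at h1
    exact one_ne_zero h1
  have hrange (v : ι → ℝ) : R.jacobian q r η v ∈ tangentSpace ι := by
    have h1 : v - (∑ σ, v σ) • η ∈ tangentSpace ι := by
      rw [hT, LinearMap.mem_ker]
      simp [← Finset.mul_sum, h.1.2]
    have h2 := R.jacobian_mem_tangentSpace q r η _ h1
    rwa [map_sub, map_smul, h.jacobian_self (by lia) hr, smul_zero, sub_zero] at h2
  rw [tangentJacobian, ← LinearMap.charpoly_eq_charpoly_restrict_mul_X _ _ hne _ hT hrange,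
    ← LinearMap.charpoly_toMatrix (R.jacobian q r η) (Pi.basisFun ℝ ι),
    LinearMap.toMatrix_eq_toMatrix']
  refine Matrix.charpoly_eq_mul_of_diagonal_rows _ _ _ fun σ hσ τ => ?_
  rw [LinearMap.toMatrix'_apply, jacobian_apply_of_notMem h.1 hq hσ]
  simp [Pi.single_apply]

/-- The complex eigenvalues of the block at the surviving opinions. -/
noncomputable def survivorEigenvalues (R : ConfidenceRule ι) (q r : ℕ) (η : ι → ℝ) :
    Multiset ℂ :=
  ((R.survivorBlock q r η).charpoly.map (algebraMap ℝ ℂ)).roots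

/-- The eigenvalues on the tangent space, together with the zero eigenvalue lost by restricting to
it, are those of the block at the surviving opinions and the decay rates of the extinct ones. -/
theorem IsFixedPoint.zero_cons_eigenvalues (h : R.IsFixedPoint q r η) (hq : 2 ≤ q) (hr : 1 ≤ r) :
    0 ::ₘ R.eigenvalues q r η = R.survivorEigenvalues q r η +
      (survivors η)ᶜ.val.map fun σ => (R.decayEigenvalue q r η σ : ℂ) := by
  replace h := congrArg (fun p => (p.map (algebraMap ℝ ℂ)).roots)
    (h.charpoly_tangentJacobian_mul_X hq hr)
  simp only [Polynomial.map_mul, Polynomial.map_X, Polynomial.map_prod, Polynomial.map_sub,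
    Polynomial.map_C] at h
  rw [Polynomial.roots_mul, Polynomial.roots_mul, Polynomial.roots_X,
    show ∏ σ ∈ (survivors η)ᶜ, (Polynomial.X - Polynomial.C (algebraMap ℝ ℂ
      (R.decayEigenvalue q r η σ))) = ((((survivors η)ᶜ.val.map fun σ =>
        (R.decayEigenvalue q r η σ : ℂ))).map fun a => Polynomial.X - Polynomial.C a).prod by
      rw [Multiset.map_map]; rfl, Polynomial.roots_multiset_prod_X_sub_C] at h
  · rw [← Multiset.singleton_add, add_comm]
    exact h
  · refine mul_ne_zero ?_ (Finset.prod_ne_zero_iff.2 fun σ _ => Polynomial.X_sub_C_ne_zero _)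
    exact ((Matrix.charpoly_monic _).map _).ne_zero
  · exact mul_ne_zero ((LinearMap.charpoly_monic _).map _).ne_zero Polynomial.X_ne_zero

/-- The nonzero eigenvalues of the block at the surviving opinions have positive real part: the
real part is a quotient of the Dirichlet form by a norm. -/
theorem IsFixedPoint.re_pos_of_mem_survivorEigenvalues (h : R.IsFixedPoint q r η) (hq : 2 ≤ q)
    (hr : 1 ≤ r) {z : ℂ} (hz : z ∈ R.survivorEigenvalues q r η) (hz0 : z ≠ 0) : 0 < z.re := by
  obtain ⟨a, b, hab, ha, hb⟩ := Matrix.exists_re_im_of_mem_roots_charpoly _ hz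
  set u := extendByZero _ a with hu
  set v := extendByZero _ b with hv
  have hJu : R.jacobian q r η u = z.re • u - z.im • v := by
    rw [hu, ← extendByZero_survivorBlock_mulVec h.1 hq, ha]
    simp [hv]
  have hJv : R.jacobian q r η v = z.im • u + z.re • v := by
    rw [hv, ← extendByZero_survivorBlock_mulVec h.1 hq, hb]
    simp [hu]
  have eu : η * (u / η) = u := mul_extendByZero_div a
  have ev : η * (v / η) = v := mul_extendByZero_div b
  have pu := h.sum_mul_jacobian_mul_nonneg (by lia) hr (u / η)
  have pv := h.sum_mul_jacobian_mul_nonneg (by lia) hr (v / η)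
  have hsum : ∑ σ, (u / η) σ * R.jacobian q r η u σ + ∑ σ, (v / η) σ * R.jacobian q r η v σ =
      z.re * ∑ σ, (u σ ^ 2 + v σ ^ 2) / η σ := by
    rw [hJu, hJv, ← Finset.sum_add_distrib, Finset.mul_sum]
    refine Finset.sum_congr rfl fun σ _ => ?_
    simp only [Pi.div_apply, Pi.sub_apply, Pi.add_apply, Pi.smul_apply, smul_eq_mul]
    ring
  have hnorm : 0 < ∑ σ, (u σ ^ 2 + v σ ^ 2) / η σ := by
    have hne : ∃ σ : survivors η, a σ ≠ 0 ∨ b σ ≠ 0 := by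
      by_contra! h0
      exact hab.elim (fun h => h (funext fun σ => (h0 σ).1)) fun h => h (funext fun σ => (h0 σ).2)
    obtain ⟨σ, hσ⟩ := hne
    refine Finset.sum_pos' (fun τ _ => div_nonneg (by positivity) (h.1.1 τ))
      ⟨σ, Finset.mem_univ _, div_pos ?_ (mem_survivors.1 σ.2)⟩
    rw [hu, hv, extendByZero_apply_coe, extendByZero_apply_coe]
    rcases hσ with hσ | hσ <;> positivity
  rw [eu] at pu
  rw [ev] at pv
  have hre : 0 ≤ z.re := by
    by_contra! hneg
    nlinarith
  refine lt_of_le_of_ne hre fun hre0 => hz0 ?_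
  -- If the real part vanishes, both Dirichlet forms do, so `u` and `v` lie in the kernel.
  rw [← hre0, zero_mul] at hsum
  have ku := (h.jacobian_mul_eq_zero_iff hq hr).2
    (h.isComponentwiseConst_of_sum_eq_zero hq hr (w := u / η) (by rw [eu]; linarith))
  have kv := (h.jacobian_mul_eq_zero_iff hq hr).2
    (h.isComponentwiseConst_of_sum_eq_zero hq hr (w := v / η) (by rw [ev]; linarith))
  rw [eu, hJu, ← hre0, zero_smul, zero_sub, neg_eq_zero, smul_eq_zero] at ku
  rw [ev, hJv, ← hre0, zero_smul, add_zero, smul_eq_zero] at kv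
  refine Complex.ext hre0.symm ?_
  rw [Complex.zero_im]
  by_contra him
  have ha0 : a = 0 := extendByZero_injective _ (by rw [map_zero]; exact kv.resolve_left him)
  have hb0 : b = 0 := extendByZero_injective _ (by rw [map_zero]; exact ku.resolve_left him)
  exact hab.elim (fun h => h ha0) fun h => h hb0

end ConfidenceRule

/-! ### Components of the surviving opinions -/

namespace ConfidenceRule

variable {ι : Type*} [Fintype ι] {R : ConfidenceRule ι} {q r : ℕ} {η : ι → ℝ}

/-- The functions on the surviving opinions that are constant on each component. -/
def componentwiseConst (R : ConfidenceRule ι) (η : ι → ℝ) :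
    Submodule ℝ (survivors η → ℝ) where
  carrier := {w | ∀ σ τ : survivors η, R.skeleton.Adj σ τ → w σ = w τ}
  add_mem' ha hb σ τ h := by simp [ha σ τ h, hb σ τ h]
  zero_mem' _ _ _ := rfl
  smul_mem' c _ ha σ τ h := by simp [ha σ τ h]

/-- The functions constant on components form the kernel of the Laplacian of the graph. -/
theorem finrank_componentwiseConst :
    Module.finrank ℝ (R.componentwiseConst η) = numComponents R.skeleton (survivors η) := by
  classical
  let G : SimpleGraph (survivors η) := (SimpleGraph.fromRel R.skeleton.Adj).comap (↑)
  have h1 : numComponents R.skeleton (survivors η) = Nat.card G.ConnectedComponent := rfl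
  rw [h1, Nat.card_eq_fintype_card, G.card_connectedComponent_eq_finrank_ker_toLin'_lapMatrix]
  have h2 : R.componentwiseConst η = LinearMap.ker (G.lapMatrix ℝ).toLin' := by
    ext w
    rw [LinearMap.mem_ker, Matrix.toLin'_apply, G.lapMatrix_mulVec_eq_zero_iff_forall_adj]
    constructor
    · intro hw σ τ hadj
      rcases hadj.2 with h | h
      · exact hw σ τ h
      · exact (hw τ σ h).symm
    · intro hw σ τ hadj
      by_cases hστ : σ = τ
      · rw [hστ]
      · exact hw σ τ ⟨fun h => hστ (Subtype.ext h), Or.inl hadj⟩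
  rw [h2]

/-- Multiplication by the proportions of the surviving opinions. -/
noncomputable def mulSurvivors (η : ι → ℝ) : (survivors η → ℝ) ≃ₗ[ℝ] (survivors η → ℝ) :=
  LinearEquiv.piCongrRight fun σ => LinearEquiv.smulOfNeZero ℝ ℝ (η σ) (mem_survivors.1 σ.2).ne'

theorem mulSurvivors_apply (x : survivors η → ℝ) (σ : survivors η) :
    mulSurvivors η x σ = η σ * x σ := rfl

theorem decayEigenvalue_nonpos (hη : η ∈ stdSimplex ℝ ι) (σ : ι) :
    R.decayEigenvalue q r η σ ≤ 0 :=
  neg_nonpos.2 <| mul_nonneg (Nat.cast_nonneg r) <| Finset.sum_nonneg fun τ _ =>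
    mul_nonneg (pow_nonneg (hη.1 τ) q) (R.nonneg σ τ)

theorem decayEigenvalue_eq_zero_iff (hr : 1 ≤ r) (hη : η ∈ stdSimplex ℝ ι) {σ : ι} :
    R.decayEigenvalue q r η σ = 0 ↔ σ ∉ predecessors R.skeleton (survivors η) := by
  have hr0 : (r : ℝ) ≠ 0 := by positivity
  rw [decayEigenvalue, neg_eq_zero, mul_eq_zero, or_iff_right hr0,
    Finset.sum_eq_zero_iff_of_nonneg fun τ _ => mul_nonneg (pow_nonneg (hη.1 τ) q) (R.nonneg σ τ)]
  simp only [predecessors, Finset.mem_filter, Finset.mem_univ, true_and, not_exists, not_and]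
  refine forall₂_congr fun τ hτ => ?_
  rw [mul_eq_zero, or_iff_right (pow_ne_zero q (mem_survivors.1 hτ).ne')]
  simp [skeleton]

theorem decayEigenvalue_neg_iff (hr : 1 ≤ r) (hη : η ∈ stdSimplex ℝ ι) {σ : ι} :
    R.decayEigenvalue q r η σ < 0 ↔ σ ∈ predecessors R.skeleton (survivors η) := by
  rw [lt_iff_le_and_ne, and_iff_right (decayEigenvalue_nonpos hη σ), Ne,
    decayEigenvalue_eq_zero_iff hr hη, not_not]

variable [DecidableEq ι]

theorem extendByZero_mulSurvivors (x : survivors η → ℝ) :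
    extendByZero _ (mulSurvivors η x) = η * extendByZero _ x := by
  ext σ
  by_cases hσ : σ ∈ survivors η
  · rw [extendByZero_apply_coe _ ⟨σ, hσ⟩, Pi.mul_apply, extendByZero_apply_coe _ ⟨σ, hσ⟩,
      mulSurvivors_apply]
  · rw [extendByZero_apply_of_notMem _ hσ, Pi.mul_apply, extendByZero_apply_of_notMem _ hσ,
      mul_zero]

theorem isComponentwiseConst_extendByZero {x : survivors η → ℝ} :
    R.IsComponentwiseConst η (extendByZero _ x) ↔ x ∈ R.componentwiseConst η := by
  constructor
  · intro h σ τ hadj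
    simpa only [extendByZero_apply_coe] using h σ σ.2 τ τ.2 hadj
  · intro h σ hσ τ hτ hadj
    rw [extendByZero_apply_coe _ ⟨σ, hσ⟩, extendByZero_apply_coe _ ⟨τ, hτ⟩]
    exact h ⟨σ, hσ⟩ ⟨τ, hτ⟩ hadj

theorem IsFixedPoint.ker_survivorBlock (h : R.IsFixedPoint q r η) (hq : 2 ≤ q) (hr : 1 ≤ r) :
    LinearMap.ker (R.survivorBlock q r η).toLin' =
      (R.componentwiseConst η).map (mulSurvivors η : (survivors η → ℝ) →ₗ[ℝ] _) := by
  ext y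
  obtain ⟨x, rfl⟩ := (mulSurvivors η).surjective y
  rw [LinearMap.mem_ker, Matrix.toLin'_apply, Submodule.mem_map_equiv,
    LinearEquiv.symm_apply_apply, ← isComponentwiseConst_extendByZero,
    ← h.jacobian_mul_eq_zero_iff hq hr, ← extendByZero_mulSurvivors,
    ← extendByZero_survivorBlock_mulVec h.1 hq,
    ← (extendByZero_injective (survivors η)).eq_iff, map_zero]

/-- The eigenvalue `0` of the block at the surviving opinions is semisimple, so its algebraic
multiplicity is the dimension of the kernel. -/
theorem IsFixedPoint.maxGenEigenspace_survivorBlock (h : R.IsFixedPoint q r η) (hq : 2 ≤ q)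
    (hr : 1 ≤ r) :
    Module.End.maxGenEigenspace (R.survivorBlock q r η).toLin' 0 =
      LinearMap.ker (R.survivorBlock q r η).toLin' := by
  have hss (x : survivors η → ℝ) (hx : (R.survivorBlock q r η).toLin'
      ((R.survivorBlock q r η).toLin' x) = 0) : (R.survivorBlock q r η).toLin' x = 0 := by
    rw [Matrix.toLin'_apply, Matrix.toLin'_apply] at hx
    rw [Matrix.toLin'_apply]
    refine extendByZero_injective _ ?_
    rw [map_zero, extendByZero_survivorBlock_mulVec h.1 hq]
    refine h.jacobian_eq_zero_of_jacobian_jacobian hq hr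
      (fun σ hσ => extendByZero_apply_of_notMem x hσ) ?_
    rw [← extendByZero_survivorBlock_mulVec h.1 hq, ← extendByZero_survivorBlock_mulVec h.1 hq,
      hx, map_zero]
  ext x
  rw [Module.End.mem_maxGenEigenspace, LinearMap.mem_ker, zero_smul, sub_zero]
  refine ⟨?_, fun hx => ⟨1, by rwa [pow_one]⟩⟩
  rintro ⟨m, hm⟩
  induction m generalizing x with
  | zero => rw [pow_zero, Module.End.one_apply] at hm; rw [hm, map_zero]
  | succ m ih => exact hss x (ih _ (by rwa [pow_succ, Module.End.mul_apply] at hm))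

theorem IsFixedPoint.count_zero_survivorEigenvalues (h : R.IsFixedPoint q r η) (hq : 2 ≤ q)
    (hr : 1 ≤ r) :
    (R.survivorEigenvalues q r η).count 0 = numComponents R.skeleton (survivors η) := by
  rw [survivorEigenvalues, Polynomial.count_roots, ← map_zero (algebraMap ℝ ℂ),
    ← Polynomial.eq_rootMultiplicity_map (algebraMap ℝ ℂ).injective, ← Matrix.charpoly_toLin',
    ← LinearMap.finrank_maxGenEigenspace_eq, h.maxGenEigenspace_survivorBlock hq hr,
    h.ker_survivorBlock hq hr, LinearEquiv.finrank_map_eq, finrank_componentwiseConst]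

theorem card_survivorEigenvalues :
    (R.survivorEigenvalues q r η).card = (survivors η).card := by
  rw [survivorEigenvalues, IsAlgClosed.card_roots_eq_natDegree, Polynomial.natDegree_map,
    Matrix.charpoly_natDegree_eq_dim, Fintype.card_coe]

theorem IsFixedPoint.countP_re_neg_eigenvalues (h : R.IsFixedPoint q r η) (hq : 2 ≤ q)
    (hr : 1 ≤ r) [DecidablePred fun z : ℂ => z.re < 0] :
    (R.eigenvalues q r η).countP (fun z => z.re < 0) =
      ((survivors η)ᶜ ∩ predecessors R.skeleton (survivors η)).card := by
  have h1 := congrArg (Multiset.countP fun z : ℂ => z.re < 0) (h.zero_cons_eigenvalues hq hr)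
  have h2 : (R.survivorEigenvalues q r η).countP (fun z => z.re < 0) = 0 := by
    refine Multiset.countP_eq_zero.2 fun z hz hneg => ?_
    have := h.re_pos_of_mem_survivorEigenvalues hq hr hz fun h0 => by simp [h0] at hneg
    exact lt_asymm this hneg
  rw [Multiset.countP_cons_of_neg _ (by simp), Multiset.countP_add, h2, zero_add,
    Multiset.countP_map] at h1
  rw [h1]
  simp only [Complex.ofReal_re, decayEigenvalue_neg_iff hr h.1]
  rw [← Finset.filter_val, Finset.card_val, Finset.filter_mem_eq_inter]

theorem IsFixedPoint.countP_re_pos_eigenvalues (h : R.IsFixedPoint q r η) (hq : 2 ≤ q)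
    (hr : 1 ≤ r) [DecidablePred fun z : ℂ => 0 < z.re] :
    (R.eigenvalues q r η).countP (fun z => 0 < z.re) + numComponents R.skeleton (survivors η) =
      (survivors η).card := by
  have h1 := congrArg (Multiset.countP fun z : ℂ => 0 < z.re) (h.zero_cons_eigenvalues hq hr)
  have h2 : ((survivors η)ᶜ.val.map fun σ => (R.decayEigenvalue q r η σ : ℂ)).countP
      (fun z => 0 < z.re) = 0 := by
    refine Multiset.countP_eq_zero.2 fun z hz hpos => ?_
    obtain ⟨σ, -, rfl⟩ := Multiset.mem_map.1 hz
    exact not_lt.2 (decayEigenvalue_nonpos h.1 σ) hpos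
  rw [Multiset.countP_cons_of_neg _ (by simp), Multiset.countP_add, h2, add_zero] at h1
  rw [h1, ← h.count_zero_survivorEigenvalues hq hr, ← card_survivorEigenvalues (R := R) (q := q)
    (r := r), Multiset.card_eq_countP_add_countP (fun z : ℂ => 0 < z.re), Multiset.count]
  congr 1
  refine Multiset.countP_congr rfl fun z hz => ?_
  refine propext ⟨?_, fun hz1 => ?_⟩
  · rintro rfl
    simp
  · by_contra hz0
    exact hz1 (h.re_pos_of_mem_survivorEigenvalues hq hr hz (Ne.symm hz0))

/-! ### Directions with no movement -/

/-- The vectors `η w`, where `w` is constant on each component of the surviving opinions and has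
mean zero with respect to `η`. -/
noncomputable def noMovementSpace (R : ConfidenceRule ι) (η : ι → ℝ) : Submodule ℝ (ι → ℝ) :=
  (R.componentwiseConst η ⊓
    LinearMap.ker (∑ σ : survivors η, η σ • LinearMap.proj σ : (survivors η → ℝ) →ₗ[ℝ] ℝ)).map
    (extendByZero (survivors η) ∘ₗ (mulSurvivors η : (survivors η → ℝ) →ₗ[ℝ] _))

theorem finrank_noMovementSpace_add_one (hη : η ∈ stdSimplex ℝ ι) :
    Module.finrank ℝ (R.noMovementSpace η) + 1 =
      numComponents R.skeleton (survivors η) := by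
  set φ : (survivors η → ℝ) →ₗ[ℝ] ℝ := ∑ σ : survivors η, η σ • LinearMap.proj σ with hφ
  have hinj : Function.Injective
      (extendByZero (survivors η) ∘ₗ (mulSurvivors η : (survivors η → ℝ) →ₗ[ℝ] _)) :=
    (extendByZero_injective _).comp (mulSurvivors η).injective
  have hone : (1 : survivors η → ℝ) ∈ R.componentwiseConst η := fun _ _ _ => rfl
  have hne : φ.domRestrict (R.componentwiseConst η) ≠ 0 := fun h0 => by
    have h1 := LinearMap.congr_fun h0 ⟨1, hone⟩
    have h2 : ∑ σ : survivors η, η σ = 1 := by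
      rw [Finset.sum_coe_sort (survivors η) η, sum_survivors hη]
    rw [LinearMap.domRestrict_apply, LinearMap.zero_apply, hφ] at h1
    simp only [LinearMap.sum_apply, LinearMap.smul_apply, LinearMap.proj_apply, Pi.one_apply,
      smul_eq_mul, mul_one, h2] at h1
    exact one_ne_zero h1
  rw [noMovementSpace, ← hφ, ← Submodule.map_comap_subtype, ← LinearMap.ker_domRestrict,
    ← (Submodule.equivMapOfInjective _ hinj _).finrank_eq,
    ← (Submodule.equivMapOfInjective _ (Submodule.subtype_injective _) _).finrank_eq,
    Module.Dual.finrank_ker_add_one_of_ne_zero hne, finrank_componentwiseConst]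

theorem mem_noMovementSpace_iff {v : ι → ℝ} :
    v ∈ R.noMovementSpace η ↔ (∀ σ ∉ survivors η, v σ = 0) ∧ ∑ σ, v σ = 0 ∧
      R.IsComponentwiseConst η (v / η) := by
  have hsum (x : survivors η → ℝ) : ∑ σ, (η * extendByZero _ x) σ =
      ∑ σ : survivors η, η σ * x σ := by
    rw [← Finset.sum_subset (Finset.subset_univ (survivors η)) fun τ _ hτ => by
      rw [Pi.mul_apply, extendByZero_apply_of_notMem x hτ, mul_zero],
      ← Finset.sum_coe_sort (survivors η) fun τ => (η * extendByZero _ x) τ]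
    exact Finset.sum_congr rfl fun τ _ => by rw [Pi.mul_apply, extendByZero_apply_coe]
  simp only [noMovementSpace, Submodule.mem_map, Submodule.mem_inf, LinearMap.mem_ker,
    LinearMap.comp_apply, LinearEquiv.coe_coe, extendByZero_mulSurvivors, LinearMap.sum_apply,
    LinearMap.smul_apply, LinearMap.proj_apply, smul_eq_mul, ← hsum]
  constructor
  · rintro ⟨x, ⟨hx, hx0⟩, rfl⟩
    refine ⟨fun σ hσ => ?_, hx0, fun σ hσ τ hτ hadj => ?_⟩
    · rw [Pi.mul_apply, extendByZero_apply_of_notMem x hσ, mul_zero]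
    · have := isComponentwiseConst_extendByZero.2 hx σ hσ τ hτ hadj
      rwa [Pi.div_apply, Pi.div_apply, Pi.mul_apply, Pi.mul_apply,
        mul_div_cancel_left₀ _ (mem_survivors.1 hσ).ne',
        mul_div_cancel_left₀ _ (mem_survivors.1 hτ).ne']
  · rintro ⟨h1, h2, h3⟩
    have hx : extendByZero _ (fun σ : survivors η => (v / η) σ) = v / η := by
      ext σ
      by_cases hσ : σ ∈ survivors η
      · rw [extendByZero_apply_coe _ ⟨σ, hσ⟩]
      · rw [extendByZero_apply_of_notMem _ hσ, Pi.div_apply, h1 σ hσ, zero_div]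
    refine ⟨fun σ : survivors η => (v / η) σ, ⟨fun σ τ => h3 σ σ.2 τ τ.2, ?_⟩, ?_⟩ <;>
      rw [hx, mul_div_eq_of_support h1]
    exact h2

/-- Fixed points on a segment through `η` in its interior differ by a rescaling of the components:
the velocity lies in the kernel of the Jacobian, and conversely such a rescaling keeps the balance
of the fluxes. -/
theorem IsFixedPoint.eventually_isFixedPoint_iff (h : R.IsFixedPoint q r η) (hq : 2 ≤ q)
    (hr : 1 ≤ r) {v : ι → ℝ} :
    (∀ᶠ t : ℝ in 𝓝 0, R.IsFixedPoint q r (η + t • v)) ↔ v ∈ R.noMovementSpace η := by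
  rw [mem_noMovementSpace_iff]
  constructor
  · intro hev
    obtain ⟨ε, hε, hball⟩ := Metric.eventually_nhds_iff.1 hev
    have hp := hball (y := ε / 2) (by rw [Real.dist_eq, sub_zero, abs_of_pos] <;> linarith)
    have hm := hball (y := -(ε / 2)) (by
      rw [Real.dist_eq, sub_zero, abs_neg, abs_of_pos] <;> linarith)
    have hs (σ : ι) (hσ : σ ∉ survivors η) : v σ = 0 := by
      have h1 := hp.1.1 σ
      have h2 := hm.1.1 σ
      simp only [Pi.add_apply, Pi.smul_apply, smul_eq_mul,
        eq_zero_of_notMem_survivors h.1 hσ] at h1 h2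
      have h3 : 0 ≤ v σ := by
        by_contra! hneg
        nlinarith
      nlinarith
    refine ⟨hs, ?_, ?_⟩
    · have h1 := hp.1.2
      simp only [Pi.add_apply, Pi.smul_apply, smul_eq_mul, Finset.sum_add_distrib,
        ← Finset.mul_sum, h.1.2] at h1
      have h2 : ε / 2 * ∑ σ, v σ = 0 := by linarith
      exact (mul_eq_zero.1 h2).resolve_left (by positivity)
    · rw [← h.jacobian_mul_eq_zero_iff hq hr, mul_div_eq_of_support hs]
      have hline : HasDerivAt (fun t : ℝ => η + t • v) v 0 := by
        simpa using ((hasDerivAt_id (0 : ℝ)).smul_const v).const_add η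
      have hF := (R.differentiable_meanField q r (η + (0 : ℝ) • v)).hasFDerivAt
      have h1 := hF.comp_hasDerivAt (0 : ℝ) hline
      have h2 : HasDerivAt (R.meanField q r ∘ fun t : ℝ => η + t • v) 0 0 :=
        (hasDerivAt_const (0 : ℝ) (0 : ι → ℝ)).congr_of_eventuallyEq
          (hev.mono fun t ht => ht.2)
      simpa [jacobian] using h1.unique h2
  · rintro ⟨hs, hsum, hw⟩
    have hpos : ∀ᶠ t : ℝ in 𝓝 0, ∀ σ, 0 < 1 + t * (v / η) σ := by
      refine eventually_all.2 fun σ => ?_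
      have hc : Continuous fun t : ℝ => 1 + t * (v / η) σ := by fun_prop
      exact hc.continuousAt.eventually_const_lt (by simp)
    filter_upwards [hpos] with t ht
    have he : η + t • v = η * fun σ => 1 + t * (v / η) σ := by
      ext σ
      have := congrFun (mul_div_eq_of_support hs) σ
      simp only [Pi.add_apply, Pi.smul_apply, smul_eq_mul, Pi.mul_apply] at this ⊢
      linear_combination -t * this
    refine ⟨⟨fun σ => ?_, ?_⟩, ?_⟩
    · rw [he]
      exact mul_nonneg (h.1.1 σ) (ht σ).le
    · simp [Finset.sum_add_distrib, ← Finset.mul_sum, h.1.2, hsum]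
    · rw [he]
      exact h.meanField_mul_eq_zero (by lia) hr fun σ hσ τ hτ hadj => by
        simp only [hw σ hσ τ hτ hadj]

theorem IsFixedPoint.noMovementDirections_add_one (h : R.IsFixedPoint q r η) (hq : 2 ≤ q)
    (hr : 1 ≤ r) :
    R.noMovementDirections q r η + 1 = numComponents R.skeleton (survivors η) := by
  rw [← finrank_noMovementSpace_add_one h.1, noMovementDirections]
  have hset : {v : ι → ℝ | ∀ᶠ t : ℝ in 𝓝 0, R.IsFixedPoint q r (η + t • v)} =
      (R.noMovementSpace η : Set (ι → ℝ)) :=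
    Set.ext fun _ => h.eventually_isFixedPoint_iff hq hr
  rw [hset, Submodule.span_eq]

end ConfidenceRule

/-! ### Trajectories -/

/-- A mean value inequality for functions with one-sided derivatives at the end points. -/
theorem mul_sub_le_sub_of_le_hasDerivWithinAt {f f' : ℝ → ℝ} {T d : ℝ}
    (hf : ∀ t ∈ Icc 0 T, HasDerivWithinAt f (f' t) (Icc 0 T) t) (hd : ∀ t ∈ Icc 0 T, d ≤ f' t)
    {s t : ℝ} (hs : 0 ≤ s) (hst : s ≤ t) (ht : t ≤ T) : d * (t - s) ≤ f t - f s := by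
  have hderiv (x : ℝ) (hx : x ∈ interior (Icc 0 T)) : HasDerivAt f (f' x) x := by
    rw [interior_Icc] at hx
    exact (hf x (Ioo_subset_Icc_self hx)).hasDerivAt (Icc_mem_nhds hx.1 hx.2)
  refine (convex_Icc 0 T).mul_sub_le_image_sub_of_le_deriv
    (fun x hx => (hf x hx).continuousWithinAt)
    (fun x hx => (hderiv x hx).differentiableAt.differentiableWithinAt) (fun x hx => ?_)
    s ⟨hs, hst.trans ht⟩ t ⟨hs.trans hst, ht⟩ hst
  rw [(hderiv x hx).deriv]
  exact hd x (interior_subset hx)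

namespace ConfidenceRule

theorem single_one_nonneg {ι : Type*} [DecidableEq ι] (σ ρ : ι) :
    0 ≤ (Pi.single σ 1 : ι → ℝ) ρ := by
  by_cases h : ρ = σ
  · simp [h]
  · simp [h]

variable {ι : Type*} [Fintype ι] {R : ConfidenceRule ι} {q r : ℕ} {η : ι → ℝ}

theorem eq_zero_of_mem_onlySurviving {Γ : Finset ι} {x : ι → ℝ} (hx : x ∈ onlySurviving Γ) {ρ : ι}
    (hρ : ρ ∉ Γ) : x ρ = 0 := by
  classical
  have h1 := Finset.sum_add_sum_compl Γ x
  rw [hx.2, hx.1.2, add_eq_left, Finset.sum_eq_zero_iff_of_nonneg fun τ _ => hx.1.1 τ] at h1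
  exact h1 ρ (Finset.mem_compl.2 hρ)

theorem contDiff_meanField : ContDiff ℝ 1 (R.meanField q r) := by
  unfold meanField
  fun_prop

theorem meanField_apply_of_eq_zero {x : ι → ℝ} {ρ : ι} (h : x ρ = 0) :
    R.meanField q r x ρ = 0 := by
  simp [meanField, h]

/-- Trajectories with a prescribed set of surviving opinions exist for a short time. -/
theorem exists_isTrajectoryIn {Γ : Finset ι} {x₀ : ι → ℝ} (hx : x₀ ∈ stdSimplex ℝ ι)
    (hpos : ∀ ρ ∈ Γ, 0 < x₀ ρ) (hzero : ∀ ρ ∉ Γ, x₀ ρ = 0) {U : Set (ι → ℝ)} (hU : U ∈ 𝓝 x₀) :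
    ∃ T > 0, ∃ x : ℝ → ι → ℝ, x 0 = x₀ ∧ R.IsTrajectoryIn q r (U ∩ onlySurviving Γ) T x := by
  classical
  -- The solution is that of the vector field composed with the projection that forgets the other
  -- opinions; this field vanishes on their coordinates, which therefore remain zero.
  let P : (ι → ℝ) → ι → ℝ := fun y ρ => if ρ ∈ Γ then y ρ else 0
  have hP : ContDiff ℝ 1 P := by
    refine contDiff_pi.2 fun ρ => ?_
    by_cases hρ : ρ ∈ Γ <;> simp only [P, hρ, if_true, if_false] <;> fun_prop
  obtain ⟨α, hα0, ε, hε, hα⟩ := ((contDiff_meanField (R := R) (q := q) (r := r)).comp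
    hP).contDiffAt (x := x₀).exists_forall_mem_closedBall_exists_eq_forall_mem_Ioo_hasDerivAt₀ 0
  have hcont : ContinuousAt α 0 := (hα 0 (by simpa using hε)).continuousAt
  have hev : ∀ᶠ t in 𝓝 (0 : ℝ), α t ∈ U ∧ ∀ ρ ∈ Γ, 0 < α t ρ := by
    rw [← hα0] at hU
    refine (hcont.eventually_mem hU).and ((Finset.eventually_all Γ).2 fun ρ hρ => ?_)
    have : ContinuousAt (fun t => α t ρ) 0 := continuousAt_pi.1 hcont ρ
    exact this.eventually_const_lt (by simpa only [hα0] using hpos ρ hρ)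
  obtain ⟨δ, hδ, hball⟩ := Metric.eventually_nhds_iff.1 hev
  set T := min ε δ / 2 with hT
  have hT0 : 0 < T := by positivity
  have hTε : T < ε := by have := min_le_left ε δ; linarith
  have hTδ : T < δ := by have := min_le_right ε δ; linarith
  have hder (t : ℝ) (ht : t ∈ Icc 0 T) :
      HasDerivWithinAt α (R.meanField q r (P (α t))) (Icc 0 T) t :=
    (hα t ⟨by linarith [ht.1], by linarith [ht.2]⟩).hasDerivWithinAt
  have hconst {f : ℝ → ℝ} (hf : ∀ t ∈ Icc 0 T, HasDerivWithinAt f 0 (Icc 0 T) t) {t : ℝ}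
      (ht : t ∈ Icc 0 T) : f t = f 0 := by
    have h1 := mul_sub_le_sub_of_le_hasDerivWithinAt hf (d := 0) (fun _ _ => le_rfl) le_rfl
      ht.1 ht.2
    have h2 := mul_sub_le_sub_of_le_hasDerivWithinAt (fun t ht => (hf t ht).fun_neg) (d := 0)
      (fun _ _ => by simp) le_rfl ht.1 ht.2
    linarith
  have hz (t : ℝ) (ht : t ∈ Icc 0 T) (ρ : ι) (hρ : ρ ∉ Γ) : α t ρ = 0 := by
    rw [hconst (f := fun t => α t ρ) (fun s hs => ?_) ht, hα0, hzero ρ hρ]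
    have h1 := hasDerivWithinAt_pi.1 (hder s hs) ρ
    rwa [meanField_apply_of_eq_zero (by simp [P, hρ])] at h1
  have hPα (t : ℝ) (ht : t ∈ Icc 0 T) : P (α t) = α t := by
    ext ρ
    by_cases hρ : ρ ∈ Γ
    · simp [P, hρ]
    · simp [P, hρ, hz t ht ρ hρ]
  have hsum (t : ℝ) (ht : t ∈ Icc 0 T) : ∑ ρ, α t ρ = 1 := by
    rw [hconst (f := fun t => ∑ ρ, α t ρ) (fun s hs => ?_) ht, hα0, hx.2]
    have h1 := HasDerivWithinAt.fun_sum fun ρ (_ : ρ ∈ Finset.univ) =>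
      hasDerivWithinAt_pi.1 (hder s hs) ρ
    rwa [sum_meanField] at h1
  refine ⟨T, hT0, α, hα0, fun t ht => ⟨?_, by simpa only [hPα t ht] using hder t ht⟩⟩
  have hb := hball (y := t) (by rw [Real.dist_eq, sub_zero, abs_of_nonneg ht.1]; linarith [ht.2])
  refine ⟨hb.1, ⟨fun ρ => ?_, hsum t ht⟩, ?_⟩
  · by_cases hρ : ρ ∈ Γ
    · exact (hb.2 ρ hρ).le
    · exact (hz t ht ρ hρ).ge
  · rw [← hsum t ht]
    exact Finset.sum_subset (Finset.subset_univ _) fun ρ _ hρ => hz t ht ρ hρ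

/-! ### Perturbations by extinct opinions -/

/-- The state obtained from `η` by adding the proportions `t v` of extinct opinions, at the
expense of all the surviving opinions, proportionally. -/
def perturb (η v : ι → ℝ) (t : ℝ) : ι → ℝ :=
  η + t • (v - (∑ ρ, v ρ) • η)

theorem perturb_apply_of_mem {v : ι → ℝ} (hv : ∀ ρ ∈ survivors η, v ρ = 0) (t : ℝ) {ρ : ι}
    (hρ : ρ ∈ survivors η) : perturb η v t ρ = (1 - t * ∑ τ, v τ) * η ρ := by
  simp only [perturb, Pi.add_apply, Pi.smul_apply, Pi.sub_apply, smul_eq_mul, hv ρ hρ]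
  ring

theorem perturb_apply_of_notMem (hη : η ∈ stdSimplex ℝ ι) (v : ι → ℝ) (t : ℝ) {ρ : ι}
    (hρ : ρ ∉ survivors η) : perturb η v t ρ = t * v ρ := by
  simp [perturb, eq_zero_of_notMem_survivors hη hρ]

theorem perturb_mem_stdSimplex (hη : η ∈ stdSimplex ℝ ι) {v : ι → ℝ}
    (hv : ∀ ρ ∈ survivors η, v ρ = 0) (hv0 : ∀ ρ, 0 ≤ v ρ) {t : ℝ} (ht : 0 ≤ t)
    (ht1 : t * ∑ τ, v τ ≤ 1) : perturb η v t ∈ stdSimplex ℝ ι := by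
  refine ⟨fun ρ => ?_, ?_⟩
  · by_cases hρ : ρ ∈ survivors η
    · rw [perturb_apply_of_mem hv t hρ]
      exact mul_nonneg (by linarith) (hη.1 ρ)
    · rw [perturb_apply_of_notMem hη v t hρ]
      exact mul_nonneg ht (hv0 ρ)
  · simp [perturb, Finset.sum_add_distrib, ← Finset.mul_sum, hη.2]

theorem tendsto_perturb (η v : ι → ℝ) : Tendsto (perturb η v) (𝓝[>] 0) (𝓝 η) := by
  have h : Continuous (perturb η v) := by
    unfold perturb
    fun_prop
  have h1 : Tendsto (perturb η v) (𝓝[>] 0) (𝓝 (perturb η v 0)) :=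
    (h.tendsto 0).mono_left nhdsWithin_le_nhds
  simpa [perturb] using h1

theorem eventually_mul_lt_one (s : ℝ) : ∀ᶠ t : ℝ in 𝓝[>] 0, 0 < t ∧ t * s < 1 := by
  have h : Continuous fun t : ℝ => t * s := by fun_prop
  have h1 : ∀ᶠ t : ℝ in 𝓝 0, t * s < 1 := h.continuousAt.eventually_lt_const (by simp)
  filter_upwards [self_mem_nhdsWithin, nhdsWithin_le_nhds h1] with t ht ht1 using ⟨ht, ht1⟩

/-! ### Degenerate directions -/

theorem mem_predecessors {S : Digraph ι} {Δ : Finset ι} {σ : ι} :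
    σ ∈ predecessors S Δ ↔ ∃ τ ∈ Δ, S.Adj σ τ := by
  simp [predecessors]

theorem mem_successors {S : Digraph ι} {Δ : Finset ι} {σ : ι} :
    σ ∈ successors S Δ ↔ ∃ τ ∈ Δ, S.Adj τ σ := by
  simp [successors]

theorem p_eq_zero_of_notMem_predecessors {Δ : Finset ι} {σ τ : ι}
    (hσ : σ ∉ predecessors R.skeleton Δ) (hτ : τ ∈ Δ) : R.p σ τ = 0 := by
  by_contra h
  exact hσ (mem_predecessors.2 ⟨τ, hτ, h⟩)

theorem p_eq_zero_of_notMem_successors {Δ : Finset ι} {σ τ : ι}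
    (hσ : σ ∉ successors R.skeleton Δ) (hτ : τ ∈ Δ) : R.p τ σ = 0 := by
  by_contra h
  exact hσ (mem_successors.2 ⟨τ, hτ, h⟩)

variable [DecidableEq ι]

theorem IsFixedPoint.isDegenerateAlong_iff (h : R.IsFixedPoint q r η) (hq : 2 ≤ q) (hr : 1 ≤ r)
    {σ : ι} : R.IsDegenerateAlong q r η σ ↔
      σ ∉ survivors η ∧ σ ∉ predecessors R.skeleton (survivors η) := by
  rw [IsDegenerateAlong, map_sub, h.jacobian_self (by lia) hr, sub_zero]
  refine and_congr_right fun hσ => ⟨fun h0 => ?_, fun hp => ?_⟩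
  · rw [← decayEigenvalue_eq_zero_iff (q := q) hr h.1]
    have h1 := congrFun h0 σ
    rwa [jacobian_apply_of_notMem h.1 hq hσ, Pi.single_eq_same, mul_one] at h1
  · ext ρ
    by_cases hρ : ρ ∈ survivors η
    · have hρσ : ρ ≠ σ := fun he => hσ (he ▸ hρ)
      rw [jacobian_apply (by lia), Pi.zero_apply]
      refine mul_eq_zero_of_right _ (Finset.sum_eq_zero fun τ _ => ?_)
      rw [Pi.single_eq_of_ne hρσ]
      by_cases hτ : τ = σ
      · subst hτ
        rw [p_eq_zero_of_notMem_predecessors hp hρ, eq_zero_of_notMem_survivors h.1 hσ,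
          zero_pow (show q - 1 ≠ 0 by lia)]
        ring
      · rw [Pi.single_eq_of_ne hτ]
        ring
    · rw [jacobian_apply_of_notMem h.1 hq hρ, Pi.zero_apply]
      by_cases hρσ : ρ = σ
      · rw [hρσ, (decayEigenvalue_eq_zero_iff hr h.1).2 hp, zero_mul]
      · rw [Pi.single_eq_of_ne hρσ, mul_zero]

/-- The proportion of a degenerate opinion `σ` to which some surviving opinion can be converted
grows at least linearly near `η`. -/
theorem exists_nhds_linear_growth (hq : 1 ≤ q) (hr : 1 ≤ r) {σ : ι}
    (hσ : σ ∉ survivors η) (hp : σ ∉ predecessors R.skeleton (survivors η))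
    (hs : σ ∈ successors R.skeleton (survivors η)) :
    ∃ U ∈ 𝓝 η, ∃ c > 0, ∀ T ≥ 0, ∀ x : ℝ → ι → ℝ, 0 < x 0 σ →
      R.IsTrajectoryIn q r (U ∩ onlySurviving (insert σ (survivors η))) T x →
      x 0 σ + c * x 0 σ ^ q * T ≤ x T σ := by
  obtain ⟨τ₀, hτ₀, hadj⟩ := mem_successors.1 hs
  have hητ := mem_survivors.1 hτ₀
  have hp0 : 0 < R.p τ₀ σ := lt_of_le_of_ne (R.nonneg _ _) (Ne.symm hadj)
  have hr1 : (1 : ℝ) ≤ r := by exact_mod_cast hr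
  have hU : {y : ι → ℝ | η τ₀ / 2 < y τ₀} ∈ 𝓝 η :=
    (continuous_apply τ₀).continuousAt.eventually_const_lt (by linarith)
  have hbound (y : ι → ℝ) (hy : y ∈ {y : ι → ℝ | η τ₀ / 2 < y τ₀} ∩
      onlySurviving (insert σ (survivors η))) :
      η τ₀ / 2 * R.p τ₀ σ * y σ ^ q ≤ R.meanField q r y σ := by
    have hyσ := hy.2.1.1 σ
    have hterm (τ : ι) : R.flux q y τ σ - R.flux q y σ τ = if τ = σ then 0 else
        R.flux q y τ σ := by
      split_ifs with hτ
      · rw [hτ, sub_self]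
      · rw [sub_eq_self]
        by_cases hτs : τ ∈ survivors η
        · rw [flux, p_eq_zero_of_notMem_predecessors hp hτs, mul_zero]
        · rw [flux, eq_zero_of_mem_onlySurviving hy.2 (ρ := τ) (by simp [hτ, hτs]),
            zero_pow (by lia), mul_zero, zero_mul]
    have hnn (τ : ι) : 0 ≤ if τ = σ then 0 else R.flux q y τ σ := by
      split_ifs
      · exact le_rfl
      · exact flux_nonneg hy.2.1.1 τ σ
    rw [meanField_eq_flux hq]
    simp only [hterm]
    have hsingle := Finset.single_le_sum (fun τ _ => hnn τ) (Finset.mem_univ τ₀)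
    rw [if_neg fun he : τ₀ = σ => hσ (he ▸ hτ₀)] at hsingle
    calc η τ₀ / 2 * R.p τ₀ σ * y σ ^ q ≤ R.flux q y τ₀ σ := by
          rw [flux, mul_assoc, mul_assoc, mul_comm (R.p τ₀ σ)]
          exact mul_le_mul_of_nonneg_right hy.1.le (by positivity)
      _ ≤ _ := hsingle
      _ ≤ _ := le_mul_of_one_le_left (Finset.sum_nonneg fun τ _ => hnn τ) hr1
  refine ⟨_, hU, η τ₀ / 2 * R.p τ₀ σ, by positivity, fun T hT x hx0 hx => ?_⟩
  have hder (t : ℝ) (ht : t ∈ Icc 0 T) := hasDerivWithinAt_pi.1 (hx t ht).2 σ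
  have hmono (t : ℝ) (ht : t ∈ Icc 0 T) : x 0 σ ≤ x t σ := by
    have h1 := mul_sub_le_sub_of_le_hasDerivWithinAt hder (d := 0) (fun s hs =>
      le_trans (mul_nonneg (by positivity) (pow_nonneg ((hx s hs).1.2.1.1 σ) q))
        (hbound _ (hx s hs).1)) le_rfl ht.1 ht.2
    linarith
  have h2 := mul_sub_le_sub_of_le_hasDerivWithinAt hder
    (d := η τ₀ / 2 * R.p τ₀ σ * x 0 σ ^ q) (fun s hs =>
      le_trans (mul_le_mul_of_nonneg_left (pow_le_pow_left₀ hx0.le (hmono s hs) q)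
        (by positivity)) (hbound _ (hx s hs).1)) le_rfl hT le_rfl
  rw [sub_zero] at h2
  linarith

theorem isRepulsiveAlong_of_mem_successors (hq : 1 ≤ q) (hr : 1 ≤ r)
    {σ : ι} (hσ : σ ∉ survivors η) (hp : σ ∉ predecessors R.skeleton (survivors η))
    (hs : σ ∈ successors R.skeleton (survivors η)) : R.IsRepulsiveAlong q r η σ := by
  obtain ⟨U, hU, c, hc, hgrow⟩ := exists_nhds_linear_growth hq hr hσ hp hs
  refine ⟨U, hU, fun x hx0 => ⟨fun T hT hx => ?_, fun hx => ?_⟩⟩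
  · have h1 := hgrow T hT.le x hx0 hx
    have h2 : 0 < c * x 0 σ ^ q * T := by positivity
    linarith
  · have hd : 0 < c * x 0 σ ^ q := by positivity
    -- After this time linear growth would bring the proportion above one.
    have hT : 0 < 1 / (c * x 0 σ ^ q) := by positivity
    have h1 := hgrow _ hT.le x hx0 (hx _ hT)
    rw [mul_one_div_cancel hd.ne'] at h1
    have h2 := (hx _ hT _ ⟨hT.le, le_rfl⟩).1.2.1
    have h3 := Finset.single_le_sum (fun τ _ => h2.1 τ) (Finset.mem_univ σ)
    rw [h2.2] at h3
    linarith

theorem perturb_single_apply_of_notMem (hη : η ∈ stdSimplex ℝ ι) {σ : ι} (t : ℝ)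
    {ρ : ι} (hρ : ρ ∉ insert σ (survivors η)) : perturb η (Pi.single σ 1) t ρ = 0 := by
  rw [Finset.mem_insert, not_or] at hρ
  rw [perturb_apply_of_notMem hη _ t hρ.2, Pi.single_eq_of_ne hρ.1, mul_zero]

theorem perturb_single_apply_self (hη : η ∈ stdSimplex ℝ ι) {σ : ι} (hσ : σ ∉ survivors η)
    (t : ℝ) : perturb η (Pi.single σ 1) t σ = t := by
  rw [perturb_apply_of_notMem hη _ t hσ, Pi.single_eq_same, mul_one]

theorem single_apply_of_mem_survivors {σ : ι} (hσ : σ ∉ survivors η) (ρ : ι)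
    (hρ : ρ ∈ survivors η) : (Pi.single σ 1 : ι → ℝ) ρ = 0 :=
  Pi.single_eq_of_ne (fun he => hσ (by rwa [he] at hρ)) _

/-- A repulsive direction is not vacuously attractive as well, since there are trajectories
near `η` along which the opinion `σ` is added to the surviving opinions. -/
theorem IsRepulsiveAlong.not_isAttractiveAlong {σ : ι} (h : R.IsRepulsiveAlong q r η σ)
    (hη : η ∈ stdSimplex ℝ ι) (hσ : σ ∉ survivors η) : ¬ R.IsAttractiveAlong q r η σ := by
  rintro ⟨V, hV, hattr⟩
  obtain ⟨U, hU, hrep⟩ := h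
  have hUV : interior (U ∩ V) ∈ 𝓝 η := interior_mem_nhds.2 (inter_mem hU hV)
  obtain ⟨t, ⟨ht0, ht1⟩, htU⟩ := ((eventually_mul_lt_one 1).and
    (tendsto_perturb η (Pi.single σ 1) hUV)).exists
  have hsum : ∑ τ, (Pi.single σ 1 : ι → ℝ) τ = 1 := by simp
  have hsing := single_apply_of_mem_survivors hσ
  have hpos (ρ : ι) (hρ : ρ ∈ insert σ (survivors η)) : 0 < perturb η (Pi.single σ 1) t ρ := by
    rcases Finset.mem_insert.1 hρ with rfl | hρ
    · rwa [perturb_single_apply_self hη hσ]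
    · rw [perturb_apply_of_mem hsing t hρ, hsum]
      exact mul_pos (by linarith) (mem_survivors.1 hρ)
  obtain ⟨T, hT, x, hx0, hx⟩ := exists_isTrajectoryIn (R := R) (q := q) (r := r)
    (Γ := insert σ (survivors η))
    (perturb_mem_stdSimplex hη hsing (single_one_nonneg σ) ht0.le (by rw [hsum]; exact ht1.le))
    hpos (fun ρ hρ => perturb_single_apply_of_notMem hη t hρ)
    (mem_interior_iff_mem_nhds.1 htU)
  have hxσ : 0 < x 0 σ := by
    rw [hx0, perturb_single_apply_self hη hσ]
    exact ht0
  have h1 := (hattr x hxσ).1 T hT fun s hs => ⟨⟨(hx s hs).1.1.2, (hx s hs).1.2⟩, (hx s hs).2⟩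
  have h2 := (hrep x hxσ).1 T hT fun s hs => ⟨⟨(hx s hs).1.1.1, (hx s hs).1.2⟩, (hx s hs).2⟩
  exact lt_asymm h1 h2

/-- Mixing an opinion that does not interact with the surviving ones into `η` gives a zero of the
vector field. -/
theorem IsFixedPoint.meanField_perturb_single (h : R.IsFixedPoint q r η) (hq : 1 ≤ q)
    {σ : ι} (hσ : σ ∉ survivors η)
    (hp : σ ∉ predecessors R.skeleton (survivors η))
    (hs : σ ∉ successors R.skeleton (survivors η)) (t : ℝ) :
    R.meanField q r (perturb η (Pi.single σ 1) t) = 0 := by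
  have hsum : ∑ τ, (Pi.single σ 1 : ι → ℝ) τ = 1 := by simp
  have hsing := single_apply_of_mem_survivors hσ
  have hq0 : q ≠ 0 := by lia
  set ν := perturb η (Pi.single σ 1) t with hν
  have hval (ρ : ι) (hρ : ρ ≠ σ) : ν ρ = (1 - t) * η ρ := by
    by_cases hρs : ρ ∈ survivors η
    · rw [hν, perturb_apply_of_mem hsing t hρs, hsum, mul_one]
    · rw [hν, perturb_single_apply_of_notMem h.1 t (by simp [hρ, hρs]),
        eq_zero_of_notMem_survivors h.1 hρs, mul_zero]
  have hσ0 := eq_zero_of_notMem_survivors h.1 hσ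
  have hfl (ρ τ : ι) (hne : ρ ≠ τ) :
      R.flux q ν ρ τ = (1 - t) ^ (q + 1) * R.flux q η ρ τ := by
    by_cases hρ : ρ = σ
    · subst hρ
      simp only [flux, hσ0, hval τ hne.symm]
      by_cases hτs : τ ∈ survivors η
      · simp [p_eq_zero_of_notMem_predecessors hp hτs]
      · simp [eq_zero_of_notMem_survivors h.1 hτs, hq0]
    by_cases hτ : τ = σ
    · subst hτ
      simp only [flux, hσ0, hval ρ hne]
      by_cases hρs : ρ ∈ survivors η
      · simp [p_eq_zero_of_notMem_successors hs hρs]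
      · simp [eq_zero_of_notMem_survivors h.1 hρs]
    rw [flux, flux, hval ρ hρ, hval τ hτ, mul_pow]
    ring
  ext ρ
  have hb : (1 - t) ^ (q + 1) * R.meanField q r η ρ = 0 := by rw [h.2, Pi.zero_apply, mul_zero]
  rw [Pi.zero_apply, ← hb, meanField_eq_flux hq, meanField_eq_flux hq, mul_left_comm,
    Finset.mul_sum _ _ ((1 - t) ^ (q + 1))]
  congr 1
  refine Finset.sum_congr rfl fun τ _ => ?_
  by_cases hτ : τ = ρ
  · rw [hτ, sub_self, sub_self, mul_zero]
  · rw [hfl τ ρ hτ, hfl ρ τ (Ne.symm hτ), mul_sub]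

theorem IsFixedPoint.exists_constant_trajectory (h : R.IsFixedPoint q r η) (hq : 1 ≤ q)
    {σ : ι} (hσ : σ ∉ survivors η)
    (hp : σ ∉ predecessors R.skeleton (survivors η))
    (hs : σ ∉ successors R.skeleton (survivors η)) {U : Set (ι → ℝ)} (hU : U ∈ 𝓝 η) :
    ∃ ν : ι → ℝ, 0 < ν σ ∧ ∀ T > 0,
      R.IsTrajectoryIn q r (U ∩ onlySurviving (insert σ (survivors η))) T fun _ => ν := by
  obtain ⟨t, ⟨ht0, ht1⟩, htU⟩ := ((eventually_mul_lt_one 1).and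
    (tendsto_perturb η (Pi.single σ 1) hU)).exists
  have hsum : ∑ τ, (Pi.single σ 1 : ι → ℝ) τ = 1 := by simp
  have hmem := perturb_mem_stdSimplex h.1 (single_apply_of_mem_survivors hσ)
    (single_one_nonneg σ) ht0.le (by rw [hsum]; exact ht1.le)
  refine ⟨perturb η (Pi.single σ 1) t, by rwa [perturb_single_apply_self h.1 hσ],
    fun T _ s _ => ⟨⟨htU, hmem, ?_⟩, ?_⟩⟩
  · exact (Finset.sum_subset (Finset.subset_univ _) fun ρ _ hρ =>
      perturb_single_apply_of_notMem h.1 t hρ).trans hmem.2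
  · rw [h.meanField_perturb_single hq hσ hp hs]
    exact hasDerivWithinAt_const _ _ _

theorem IsFixedPoint.isRepulsiveAlong_iff (h : R.IsFixedPoint q r η) (hq : 1 ≤ q) (hr : 1 ≤ r)
    {σ : ι} (hσ : σ ∉ survivors η) (hp : σ ∉ predecessors R.skeleton (survivors η)) :
    R.IsRepulsiveAlong q r η σ ↔ σ ∈ successors R.skeleton (survivors η) := by
  refine ⟨fun ⟨U, hU, hrep⟩ => ?_, isRepulsiveAlong_of_mem_successors hq hr hσ hp⟩
  by_contra hs
  obtain ⟨ν, hν, htraj⟩ := h.exists_constant_trajectory hq hσ hp hs hU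
  exact (hrep _ hν).2 htraj

theorem IsFixedPoint.not_isAttractiveAlong (h : R.IsFixedPoint q r η) (hq : 1 ≤ q) (hr : 1 ≤ r)
    {σ : ι} (hσ : σ ∉ survivors η) (hp : σ ∉ predecessors R.skeleton (survivors η)) :
    ¬ R.IsAttractiveAlong q r η σ := by
  by_cases hs : σ ∈ successors R.skeleton (survivors η)
  · exact (isRepulsiveAlong_of_mem_successors hq hr hσ hp hs).not_isAttractiveAlong h.1 hσ
  · rintro ⟨U, hU, hattr⟩
    obtain ⟨ν, hν, htraj⟩ := h.exists_constant_trajectory hq hσ hp hs hU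
    exact lt_irrefl _ ((hattr _ hν).1 1 one_pos (htraj 1 one_pos))

/-! ### The numbers of directions -/

theorem IsFixedPoint.unstableDirections_add (h : R.IsFixedPoint q r η) (hq : 2 ≤ q)
    (hr : 1 ≤ r) :
    R.unstableDirections q r η + numComponents R.skeleton (survivors η) =
      (survivors η).card + (((survivors η)ᶜ \ predecessors R.skeleton (survivors η)) ∩
        successors R.skeleton (survivors η)).card := by
  classical
  rw [unstableDirections, add_right_comm, h.countP_re_pos_eigenvalues hq hr]
  congr 2
  ext σ
  simp only [Finset.mem_filter, Finset.mem_univ, true_and, Finset.mem_inter, Finset.mem_sdiff,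
    Finset.mem_compl, h.isDegenerateAlong_iff hq hr]
  exact and_congr_right fun hσ => h.isRepulsiveAlong_iff (by lia) hr hσ.1 hσ.2

theorem IsFixedPoint.stableDirections_eq (h : R.IsFixedPoint q r η) (hq : 2 ≤ q) (hr : 1 ≤ r) :
    R.stableDirections q r η =
      ((survivors η)ᶜ ∩ predecessors R.skeleton (survivors η)).card := by
  classical
  rw [stableDirections, h.countP_re_neg_eigenvalues hq hr, Finset.filter_false_of_mem,
    Finset.card_empty, add_zero]
  rintro σ - ⟨hdeg, hattr⟩
  obtain ⟨hσ, hp⟩ := (h.isDegenerateAlong_iff hq hr).1 hdeg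
  exact h.not_isAttractiveAlong (by lia) hr hσ hp hattr

theorem IsFixedPoint.neutralDirections_eq (h : R.IsFixedPoint q r η) (hq : 2 ≤ q) (hr : 1 ≤ r) :
    R.neutralDirections q r η =
      ((survivors η)ᶜ \ predecessors R.skeleton (survivors η)) ∩
        ((survivors η)ᶜ \ successors R.skeleton (survivors η)) := by
  classical
  ext σ
  simp only [neutralDirections, Finset.mem_filter, Finset.mem_univ, true_and, Finset.mem_inter,
    Finset.mem_sdiff, Finset.mem_compl, h.isDegenerateAlong_iff hq hr]
  refine and_congr_right fun hσ => ?_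
  rw [h.isRepulsiveAlong_iff (by lia) hr hσ.1 hσ.2, and_iff_right hσ.1, and_iff_right]
  exact h.not_isAttractiveAlong (by lia) hr hσ.1 hσ.2

/-! ### Movement along neutral directions -/

theorem meanField_perturb_add_single (hη : η ∈ stdSimplex ℝ ι) (hq : 2 ≤ q) {σ τ : ι}
    (hσ : σ ∉ survivors η) (hp : σ ∉ predecessors R.skeleton (survivors η))
    (hs : σ ∉ successors R.skeleton (survivors η)) (hτ : τ ∉ survivors η) (hστ : τ ≠ σ)
    (a t : ℝ) :
    R.meanField q r (perturb η (Pi.single σ a + Pi.single τ 1) t) σ =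
      r * (a * t ^ (q + 1) * (a ^ (q - 1) * R.p τ σ - R.p σ τ)) := by
  obtain ⟨m, rfl⟩ : ∃ m, q = m + 2 := ⟨q - 2, by lia⟩
  rw [meanField, Finset.sum_eq_single τ]
  · simp only [perturb_apply_of_notMem hη _ t hσ, perturb_apply_of_notMem hη _ t hτ, Pi.add_apply,
      Pi.single_eq_same, Pi.single_eq_of_ne hστ, Pi.single_eq_of_ne hστ.symm,
      show m + 2 - 1 = m + 1 by lia]
    ring
  · intro ρ _ hρτ
    by_cases hρs : ρ ∈ survivors η
    · rw [p_eq_zero_of_notMem_predecessors hp hρs, p_eq_zero_of_notMem_successors hs hρs]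
      ring
    · by_cases hρσ : ρ = σ
      · rw [hρσ]
        ring
      · rw [perturb_apply_of_notMem hη _ t hρs]
        simp [Pi.single_eq_of_ne hρτ, Pi.single_eq_of_ne hρσ]
  · simp

theorem hasMovementAlong_iff (hη : η ∈ stdSimplex ℝ ι) (hq : 2 ≤ q) (hr : 1 ≤ r) {σ : ι}
    (hσ : σ ∉ survivors η) (hp : σ ∉ predecessors R.skeleton (survivors η))
    (hs : σ ∉ successors R.skeleton (survivors η)) :
    R.HasMovementAlong q r η σ ↔ ¬ IsIsolatedNode R.skeleton σ := by
  constructor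
  · intro hmove hiso
    obtain ⟨ν, hν⟩ := hmove.exists
    refine hν (mul_eq_zero_of_right _ (Finset.sum_eq_zero fun τ _ => ?_))
    by_cases hτ : τ = σ
    · rw [hτ]
      ring
    · have h1 := not_not.1 (hiso τ hτ).1
      have h2 := not_not.1 (hiso τ hτ).2
      rw [h1, h2]
      ring
  · intro hiso
    simp only [IsIsolatedNode, not_forall] at hiso
    obtain ⟨τ, hτσ, hadj⟩ := hiso
    have hpne : R.p τ σ ≠ 0 ∨ R.p σ τ ≠ 0 := by
      by_contra! h0
      exact hadj ⟨not_not.2 h0.2, not_not.2 h0.1⟩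
    have hτ : τ ∉ survivors η := fun hτs => hpne.elim
      (fun h1 => h1 (p_eq_zero_of_notMem_successors hs hτs))
      fun h1 => h1 (p_eq_zero_of_notMem_predecessors hp hτs)
    -- If equal proportions of `σ` and `τ` balance each other, a double proportion of `σ` wins.
    obtain ⟨a, ha, hne⟩ : ∃ a : ℝ, 0 < a ∧ a ^ (q - 1) * R.p τ σ - R.p σ τ ≠ 0 := by
      by_cases heq : R.p τ σ = R.p σ τ
      · refine ⟨2, two_pos, ?_⟩
        rw [← heq, or_self] at hpne
        have h1 : (1 : ℝ) < 2 ^ (q - 1) := one_lt_pow₀ one_lt_two (by lia)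
        rw [← heq, show (2 : ℝ) ^ (q - 1) * R.p τ σ - R.p τ σ = (2 ^ (q - 1) - 1) * R.p τ σ by ring]
        exact mul_ne_zero (by linarith) hpne
      · exact ⟨1, one_pos, by rwa [one_pow, one_mul, sub_ne_zero]⟩
    set v : ι → ℝ := Pi.single σ a + Pi.single τ 1 with hv
    have hv0 (ρ : ι) : 0 ≤ v ρ := by
      by_cases h1 : ρ = σ <;> by_cases h2 : ρ = τ <;> simp [hv, Pi.single_apply, h1, h2] <;>
        positivity
    have hvs (ρ : ι) (hρ : ρ ∈ survivors η) : v ρ = 0 := by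
      have h1 : ρ ≠ σ := fun he => hσ (he ▸ hρ)
      have h2 : ρ ≠ τ := fun he => hτ (he ▸ hρ)
      simp [hv, h1, h2]
    have hr0 : (r : ℝ) ≠ 0 := by positivity
    have htend : Tendsto (perturb η v) (𝓝[>] 0) (𝓝[stdSimplex ℝ ι] η) :=
      tendsto_nhdsWithin_iff.2 ⟨tendsto_perturb η v, (eventually_mul_lt_one _).mono fun t ht =>
        perturb_mem_stdSimplex hη hvs hv0 ht.1.le ht.2.le⟩
    refine htend.frequently (Eventually.frequently ?_)
    filter_upwards [self_mem_nhdsWithin] with t ht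
    rw [hv, meanField_perturb_add_single hη hq hσ hp hs hτ hτσ]
    exact mul_ne_zero hr0 (mul_ne_zero (mul_ne_zero ha.ne' (pow_ne_zero _ (ne_of_gt ht))) hne)

end ConfidenceRule

/-! ### Opinions with vanishing decay rate -/

namespace ConfidenceRule

variable {ι : Type*} [Fintype ι] {R : ConfidenceRule ι} {q r : ℕ} {η : ι → ℝ}

/-- The per capita growth rate of the opinion `σ`. -/
def growthRate (R : ConfidenceRule ι) (q r : ℕ) (y : ι → ℝ) (σ : ι) : ℝ :=
  r * ∑ τ, y τ * (y σ ^ (q - 1) * R.p τ σ - y τ ^ (q - 1) * R.p σ τ)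

theorem meanField_eq_mul_growthRate (y : ι → ℝ) (σ : ι) :
    R.meanField q r y σ = y σ * R.growthRate q r y σ := by
  rw [meanField, growthRate, mul_left_comm, Finset.mul_sum _ _ (y σ)]
  simp only [mul_assoc]

theorem continuous_growthRate (σ : ι) : Continuous fun y => R.growthRate q r y σ := by
  unfold growthRate
  fun_prop

theorem growthRate_of_notMem (hη : η ∈ stdSimplex ℝ ι) (hq : 2 ≤ q) {σ : ι}
    (hσ : σ ∉ survivors η) : R.growthRate q r η σ = R.decayEigenvalue q r η σ := by
  obtain ⟨m, rfl⟩ : ∃ m, q = m + 2 := ⟨q - 2, by lia⟩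
  rw [growthRate, decayEigenvalue, ← mul_neg, ← Finset.sum_neg_distrib,
    Finset.sum_subset (Finset.subset_univ (survivors η)) fun τ _ hτ => by
      rw [eq_zero_of_notMem_survivors hη hτ, zero_pow (by lia), zero_mul, neg_zero],
    eq_zero_of_notMem_survivors hη hσ, show m + 2 - 1 = m + 1 by lia]
  congr 1
  refine Finset.sum_congr rfl fun τ _ => ?_
  ring

/-- The fluxes inside `s` cancel in the total growth of the opinions of `s`. -/
theorem sum_meanField_eq [DecidableEq ι] (hq : 1 ≤ q) (y : ι → ℝ) (s : Finset ι) :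
    ∑ σ ∈ s, R.meanField q r y σ =
      r * ∑ σ ∈ s, ∑ τ ∈ sᶜ, (R.flux q y τ σ - R.flux q y σ τ) := by
  have hin : ∑ σ ∈ s, ∑ τ ∈ s, (R.flux q y τ σ - R.flux q y σ τ) = 0 := by
    simp only [Finset.sum_sub_distrib]
    rw [Finset.sum_comm, sub_self]
  simp only [meanField_eq_flux hq, ← Finset.mul_sum]
  congr 1
  rw [← zero_add (∑ σ ∈ s, ∑ τ ∈ sᶜ, _), ← hin, ← Finset.sum_add_distrib]
  exact Finset.sum_congr rfl fun σ _ => (Finset.sum_add_sum_compl s _).symm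

variable [DecidableEq ι]

theorem mem_nullExtinct {σ : ι} : σ ∈ R.nullExtinct q r η ↔
    σ ∉ survivors η ∧ R.decayEigenvalue q r η σ = 0 := by
  simp [nullExtinct]

/-- The opinions of `ω` exchange agents with the decaying opinions only. -/
theorem sum_nullExtinct_meanField (hη : η ∈ stdSimplex ℝ ι) (hq : 1 ≤ q) (hr : 1 ≤ r)
    (hs : ∀ σ ∈ (survivors η)ᶜ, R.decayEigenvalue q r η σ < 0 ∨
      σ ∉ successors R.skeleton (survivors η)) (y : ι → ℝ) :
    ∑ σ ∈ R.nullExtinct q r η, R.meanField q r y σ =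
      r * ∑ σ ∈ R.nullExtinct q r η, ∑ τ ∈ (survivors η)ᶜ \ R.nullExtinct q r η,
        (R.flux q y τ σ - R.flux q y σ τ) := by
  rw [sum_meanField_eq hq]
  congr 1
  refine Finset.sum_congr rfl fun σ hσ =>
    (Finset.sum_subset (fun τ hτ => ?_) fun τ hτ hτ' => ?_).symm
  · exact Finset.mem_compl.2 (Finset.mem_sdiff.1 hτ).2
  · obtain ⟨hσs, hσ0⟩ := mem_nullExtinct.1 hσ
    have hτs : τ ∈ survivors η := by
      by_contra h
      exact hτ' (Finset.mem_sdiff.2 ⟨Finset.mem_compl.2 h, Finset.mem_compl.1 hτ⟩)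
    have hsucc := (hs σ (Finset.mem_compl.2 hσs)).resolve_left (by rw [hσ0]; exact lt_irrefl 0)
    rw [flux, flux, p_eq_zero_of_notMem_successors hsucc hτs,
      p_eq_zero_of_notMem_predecessors ((decayEigenvalue_eq_zero_iff hr hη).1 hσ0) hτs]
    ring

/-- Bounds on the growth of `ω` in terms of the proportion of the decaying opinions. -/
theorem sum_nullExtinct_meanField_bounds (hη : η ∈ stdSimplex ℝ ι) (hq : 2 ≤ q) (hr : 1 ≤ r)
    (hs : ∀ σ ∈ (survivors η)ᶜ, R.decayEigenvalue q r η σ < 0 ∨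
      σ ∉ successors R.skeleton (survivors η)) {y : ι → ℝ} (hy : y ∈ stdSimplex ℝ ι) {ε : ℝ}
    (hε : ∀ τ ∈ (survivors η)ᶜ \ R.nullExtinct q r η, y τ ≤ ε) :
    -(r * ε * ((∑ σ ∈ R.nullExtinct q r η, y σ) *
        ∑ τ ∈ (survivors η)ᶜ \ R.nullExtinct q r η, y τ)) ≤
      ∑ σ ∈ R.nullExtinct q r η, R.meanField q r y σ ∧
    ∑ σ ∈ R.nullExtinct q r η, R.meanField q r y σ ≤
      r * ((∑ σ ∈ R.nullExtinct q r η, y σ) *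
        ∑ τ ∈ (survivors η)ᶜ \ R.nullExtinct q r η, y τ) := by
  have hle1 (σ : ι) : y σ ≤ 1 := by
    rw [← hy.2]
    exact Finset.single_le_sum (fun τ _ => hy.1 τ) (Finset.mem_univ σ)
  have hflux (σ τ : ι) {c : ℝ} (hc : y τ ^ q ≤ c) : R.flux q y σ τ ≤ y σ * c := by
    rw [flux]
    have h0 : 0 ≤ y σ * y τ ^ q := mul_nonneg (hy.1 σ) (pow_nonneg (hy.1 τ) q)
    exact (mul_le_of_le_one_right h0 (R.le_one σ τ)).trans
      (mul_le_mul_of_nonneg_left hc (hy.1 σ))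
  rw [sum_nullExtinct_meanField hη (by lia) hr hs, Finset.sum_mul_sum]
  constructor
  · rw [mul_assoc, ← mul_neg]
    refine mul_le_mul_of_nonneg_left ?_ (Nat.cast_nonneg r)
    rw [Finset.mul_sum, ← Finset.sum_neg_distrib]
    refine Finset.sum_le_sum fun σ _ => ?_
    rw [Finset.mul_sum, ← Finset.sum_neg_distrib]
    refine Finset.sum_le_sum fun τ hτ => ?_
    have h1 : y τ ^ q ≤ ε * y τ := calc
      y τ ^ q ≤ y τ ^ 2 := pow_le_pow_of_le_one (hy.1 τ) (hle1 τ) hq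
      _ = y τ * y τ := sq _
      _ ≤ ε * y τ := mul_le_mul_of_nonneg_right (hε τ hτ) (hy.1 τ)
    have h2 := hflux σ τ h1
    have h3 := flux_nonneg (R := R) (q := q) hy.1 τ σ
    linarith
  · refine mul_le_mul_of_nonneg_left (Finset.sum_le_sum fun σ _ => Finset.sum_le_sum
      fun τ _ => ?_) (Nat.cast_nonneg r)
    have h1 : y σ ^ q ≤ y σ := pow_le_of_le_one (hy.1 σ) (hle1 σ) (by lia)
    have h2 := hflux τ σ h1
    have h3 := flux_nonneg (R := R) (q := q) hy.1 σ τ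
    linarith

/-- While the decaying opinions fade away, at least at the rate `-L / 2`, the total proportion `N`
of the opinions of `ω` changes by a bounded factor only: with `a` the proportion of the decaying
opinions, `N exp (c a)` decreases and `N exp (-c' a)` increases for suitable `c` and `c'`. -/
theorem exists_nhds_nullExtinct_bounds (hη : η ∈ stdSimplex ℝ ι) (hq : 2 ≤ q) (hr : 1 ≤ r)
    (hs : ∀ σ ∈ (survivors η)ᶜ, R.decayEigenvalue q r η σ < 0 ∨
      σ ∉ successors R.skeleton (survivors η)) {L : ℝ} (hL : L < 0)
    (hLmax : ∀ σ ∈ (survivors η)ᶜ \ R.nullExtinct q r η, R.decayEigenvalue q r η σ ≤ L) :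
    ∃ U ∈ 𝓝 η, ∀ T ≥ 0, ∀ x : ℝ → ι → ℝ, R.IsTrajectoryIn q r (U ∩ stdSimplex ℝ ι) T x →
      (∑ σ ∈ R.nullExtinct q r η, x 0 σ) *
          Real.exp (((survivors η)ᶜ \ R.nullExtinct q r η).card * r / (q * L)) ≤
        ∑ σ ∈ R.nullExtinct q r η, x T σ ∧
      ∑ σ ∈ R.nullExtinct q r η, x T σ ≤
        (∑ σ ∈ R.nullExtinct q r η, x 0 σ) *
          Real.exp (-(((survivors η)ᶜ \ R.nullExtinct q r η).card * r / L)) := by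
  set ω := R.nullExtinct q r η
  set A := (survivors η)ᶜ \ ω
  have hq2 : (2 : ℝ) ≤ q := by exact_mod_cast hq
  have hr1 : (1 : ℝ) ≤ r := by exact_mod_cast hr
  have hL0 : L ≠ 0 := hL.ne
  -- Small enough for `2 * ε ≤ 1` (upper bound) and `2 * ε ^ 2 ≤ 1 / q` (lower bound).
  set ε : ℝ := 1 / (2 * q) with hε
  have hε0 : 0 < ε := by positivity
  have hqε : q * ε = 1 / 2 := by rw [hε]; field_simp
  have hε2 : ε ≤ 1 / 2 := by nlinarith
  have hU : {y : ι → ℝ | ∀ σ ∈ A, y σ < ε ∧ R.growthRate q r y σ < L / 2} ∈ 𝓝 η := by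
    refine (Finset.eventually_all A).2 fun σ hσ => ?_
    have hσs : σ ∉ survivors η := Finset.mem_compl.1 (Finset.mem_sdiff.1 hσ).1
    refine ((continuous_apply σ).continuousAt.eventually_lt_const ?_).and
      ((continuous_growthRate σ).continuousAt.eventually_lt_const ?_)
    · simpa only [eq_zero_of_notMem_survivors hη hσs] using hε0
    · simp only [growthRate_of_notMem hη hq hσs]
      linarith [hLmax σ hσ]
  refine ⟨_, hU, fun T hT x hx => ?_⟩
  have hdecay (t : ℝ) (ht : t ∈ Icc 0 T) :
      ∑ σ ∈ A, R.meanField q r (x t) σ ≤ L / 2 * ∑ σ ∈ A, x t σ := by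
    rw [Finset.mul_sum]
    refine Finset.sum_le_sum fun σ hσ => ?_
    rw [meanField_eq_mul_growthRate, mul_comm]
    exact mul_le_mul_of_nonneg_right ((hx t ht).1.1 σ hσ).2.le ((hx t ht).1.2.1 σ)
  have hbounds (t : ℝ) (ht : t ∈ Icc 0 T) :
      -(r * ε * ((∑ σ ∈ ω, x t σ) * ∑ τ ∈ A, x t τ)) ≤ ∑ σ ∈ ω, R.meanField q r (x t) σ ∧
        ∑ σ ∈ ω, R.meanField q r (x t) σ ≤ r * ((∑ σ ∈ ω, x t σ) * ∑ τ ∈ A, x t τ) :=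
    sum_nullExtinct_meanField_bounds hη hq hr hs (hx t ht).1.2 (ε := ε) fun τ hτ =>
      ((hx t ht).1.1 τ hτ).1.le
  have hN (t : ℝ) (ht : t ∈ Icc 0 T) : 0 ≤ ∑ σ ∈ ω, x t σ :=
    Finset.sum_nonneg fun σ _ => (hx t ht).1.2.1 σ
  have ha (t : ℝ) (ht : t ∈ Icc 0 T) : 0 ≤ ∑ σ ∈ A, x t σ :=
    Finset.sum_nonneg fun σ _ => (hx t ht).1.2.1 σ
  have hder (s : Finset ι) (t : ℝ) (ht : t ∈ Icc 0 T) :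
      HasDerivWithinAt (fun t => ∑ σ ∈ s, x t σ) (∑ σ ∈ s, R.meanField q r (x t) σ)
        (Icc 0 T) t :=
    HasDerivWithinAt.fun_sum fun σ _ => hasDerivWithinAt_pi.1 (hx t ht).2 σ
  have hlyap (c t : ℝ) (ht : t ∈ Icc 0 T) :
      HasDerivWithinAt (fun t => (∑ σ ∈ ω, x t σ) * Real.exp (c * ∑ σ ∈ A, x t σ))
        (Real.exp (c * ∑ σ ∈ A, x t σ) * (∑ σ ∈ ω, R.meanField q r (x t) σ +
          c * ((∑ σ ∈ ω, x t σ) * ∑ σ ∈ A, R.meanField q r (x t) σ))) (Icc 0 T) t := by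
    have h1 := (hder ω t ht).fun_mul ((hder A t ht).const_mul c).exp
    exact h1.congr_deriv (by ring)
  have h0 : (0 : ℝ) ∈ Icc 0 T := ⟨le_rfl, hT⟩
  have hTT : T ∈ Icc 0 T := ⟨hT, le_rfl⟩
  have hA0 : ∑ σ ∈ A, x 0 σ ≤ A.card * ε := by
    rw [← nsmul_eq_mul]
    exact Finset.sum_le_card_nsmul _ _ _ fun σ hσ => ((hx 0 h0).1.1 σ hσ).1.le
  have hcard : (0 : ℝ) ≤ A.card := Nat.cast_nonneg _
  have hprod (t : ℝ) (ht : t ∈ Icc 0 T) :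
      (∑ σ ∈ ω, x t σ) * ∑ σ ∈ A, R.meanField q r (x t) σ ≤
        L / 2 * ((∑ σ ∈ ω, x t σ) * ∑ σ ∈ A, x t σ) := by
    have := mul_le_mul_of_nonneg_left (hdecay t ht) (hN t ht)
    linarith
  constructor
  · have hc : 0 ≤ -(2 * r * ε / L) := neg_nonneg.2 (div_nonpos_of_nonneg_of_nonpos
      (by positivity) hL.le)
    have hmono := mul_sub_le_sub_of_le_hasDerivWithinAt (hlyap (-(-(2 * r * ε / L))))
      (d := 0) (fun t ht => mul_nonneg (Real.exp_nonneg _) ?_) le_rfl hT le_rfl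
    · rw [zero_mul, sub_nonneg] at hmono
      calc _ ≤ (∑ σ ∈ ω, x 0 σ) * Real.exp (-(-(2 * r * ε / L)) * ∑ σ ∈ A, x 0 σ) := by
            refine mul_le_mul_of_nonneg_left (Real.exp_le_exp.2 ?_) (hN 0 h0)
            have h1 := mul_le_mul_of_nonneg_left hA0 hc
            have h2 : (A.card : ℝ) * r / (q * L) ≤ 2 * r * ε / L * (A.card * ε) := by
              rw [div_eq_mul_inv, mul_inv, div_eq_mul_inv]
              have h3 : (q : ℝ)⁻¹ = 2 * ε := by rw [hε]; field_simp
              have h4 : L⁻¹ < 0 := inv_lt_zero.2 hL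
              have h5 : 2 * r * ε * A.card * ε ≤ A.card * r * (2 * ε) := by
                have : 0 ≤ A.card * r * ε := by positivity
                nlinarith
              rw [h3]
              nlinarith
            linarith
        _ ≤ _ := hmono
        _ ≤ _ := mul_le_of_le_one_right (hN T hTT) (Real.exp_le_one_iff.2 (by
            have := mul_nonneg hc (ha T hTT)
            linarith))
    · have h1 := (hbounds t ht).1
      have h2 := mul_le_mul_of_nonneg_left (hprod t ht) hc
      have h3 : -(2 * r * ε / L) * (L / 2 * ((∑ σ ∈ ω, x t σ) * ∑ σ ∈ A, x t σ)) =
          -(r * ε * ((∑ σ ∈ ω, x t σ) * ∑ σ ∈ A, x t σ)) := by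
        field_simp
      linarith
  · have hc : 0 ≤ -(2 * r / L) := neg_nonneg.2 (div_nonpos_of_nonneg_of_nonpos
      (by positivity) hL.le)
    have hmono := mul_sub_le_sub_of_le_hasDerivWithinAt
      (fun t ht => (hlyap (-(2 * r / L)) t ht).fun_neg)
      (d := 0) (fun t ht => neg_nonneg.2 (mul_nonpos_of_nonneg_of_nonpos (Real.exp_nonneg _) ?_))
      le_rfl hT le_rfl
    · rw [zero_mul, sub_neg_eq_add, neg_add_eq_sub, sub_nonneg] at hmono
      calc _ ≤ (∑ σ ∈ ω, x T σ) * Real.exp (-(2 * r / L) * ∑ σ ∈ A, x T σ) :=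
            le_mul_of_one_le_right (hN T hTT) (Real.one_le_exp (mul_nonneg hc (ha T hTT)))
        _ ≤ _ := hmono
        _ ≤ _ := by
            refine mul_le_mul_of_nonneg_left (Real.exp_le_exp.2 ?_) (hN 0 h0)
            have h1 := mul_le_mul_of_nonneg_left hA0 hc
            have h2 : -(2 * r / L) * (A.card * ε) ≤ -(2 * r / L) * (A.card * (1 / 2)) :=
              mul_le_mul_of_nonneg_left (mul_le_mul_of_nonneg_left hε2 hcard) hc
            have h3 : -(2 * r / L) * (A.card * (1 / 2)) = -(A.card * r / L) := by
              field_simp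
            linarith
    · have h1 := (hbounds t ht).2
      have h2 := mul_le_mul_of_nonneg_left (hprod t ht) hc
      have h3 : -(2 * r / L) * (L / 2 * ((∑ σ ∈ ω, x t σ) * ∑ σ ∈ A, x t σ)) =
          -(r * ((∑ σ ∈ ω, x t σ) * ∑ σ ∈ A, x t σ)) := by
        field_simp
      linarith

theorem exists_nhds_nullExtinct_bounds_maxDecay (hη : η ∈ stdSimplex ℝ ι) (hq : 2 ≤ q)
    (hr : 1 ≤ r)
    (hs : ∀ σ ∈ (survivors η)ᶜ, R.decayEigenvalue q r η σ < 0 ∨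
      σ ∉ successors R.skeleton (survivors η)) :
    ∃ U ∈ 𝓝 η, ∀ T ≥ 0, ∀ x : ℝ → ι → ℝ, R.IsTrajectoryIn q r (U ∩ stdSimplex ℝ ι) T x →
      (∑ σ ∈ R.nullExtinct q r η, x 0 σ) *
          Real.exp (((survivors η)ᶜ \ R.nullExtinct q r η).card * r /
            (q * R.maxDecay q r η)) ≤
        ∑ σ ∈ R.nullExtinct q r η, x T σ ∧
      ∑ σ ∈ R.nullExtinct q r η, x T σ ≤
        (∑ σ ∈ R.nullExtinct q r η, x 0 σ) *
          Real.exp (-(((survivors η)ᶜ \ R.nullExtinct q r η).card * r /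
            R.maxDecay q r η)) := by
  rcases ((survivors η)ᶜ \ R.nullExtinct q r η).eq_empty_or_nonempty with hA | hA
  · -- Both exponents vanish, whatever the value of the empty maximum.
    have h := exists_nhds_nullExtinct_bounds (L := -1) hη hq hr hs (by norm_num) (by simp [hA])
    simpa [hA] using h
  · have hfin : (R.decayEigenvalue q r η ''
        ((survivors η)ᶜ \ R.nullExtinct q r η : Finset ι)).Finite :=
      (Finset.finite_toSet _).image _
    refine exists_nhds_nullExtinct_bounds hη hq hr hs ?_ fun σ hσ =>
      le_csSup hfin.bddAbove (mem_image_of_mem _ hσ)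
    obtain ⟨σ, hσ, heq⟩ := ((Finset.coe_nonempty.2 hA).image _).csSup_mem hfin
    rw [maxDecay, ← heq]
    obtain ⟨hσs, hσ0⟩ := Finset.mem_sdiff.1 (Finset.mem_coe.1 hσ)
    exact lt_of_le_of_ne (decayEigenvalue_nonpos hη σ) fun h0 =>
      hσ0 (mem_nullExtinct.2 ⟨Finset.mem_compl.1 hσs, h0⟩)

end ConfidenceRule

/-! ### Counting the directions -/

theorem mainTheorem3 {ι : Type*} [Fintype ι] [DecidableEq ι] (R : ConfidenceRule ι) (q r : ℕ)
    (hq : 2 ≤ q) (hr : 1 ≤ r) (η : ι → ℝ) (hη : R.IsFixedPoint q r η)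
    (Δ Δpred Δsucc : Finset ι) (k : ℕ) (hΔ : Δ = survivors η)
    (hpred : Δpred = predecessors R.skeleton Δ) (hsucc : Δsucc = successors R.skeleton Δ)
    (hk : k = numComponents R.skeleton Δ) :
    -- the numbers of directions of each kind
    (R.unstableDirections q r η : ℤ) = Δ.card + ((Δᶜ \ Δpred) ∩ Δsucc).card - k ∧
    R.stableDirections q r η = (Δᶜ ∩ Δpred).card ∧
    (R.noMovementDirections q r η : ℤ) = k - 1 ∧
    (R.neutralDirections q r η).card = ((Δᶜ \ Δpred) ∩ (Δᶜ \ Δsucc)).card ∧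
    -- there is movement along a neutral direction, unless its opinion interacts with no other
    (∀ σ ∈ R.neutralDirections q r η,
      R.HasMovementAlong q r η σ ↔ ¬ IsIsolatedNode R.skeleton σ) ∧
    -- if no degenerate direction is repulsive, nearby trajectories are neither attracted to nor
    -- repelled from the manifold where the opinions with vanishing eigenvalue are extinct
    ((∀ σ ∈ Δᶜ, R.decayEigenvalue q r η σ < 0 ∨ σ ∉ Δsucc) →
      ∃ U ∈ 𝓝 η, ∀ T ≥ 0, ∀ x : ℝ → ι → ℝ, R.IsTrajectoryIn q r (U ∩ stdSimplex ℝ ι) T x →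
        (∑ σ ∈ R.nullExtinct q r η, x 0 σ) *
            Real.exp ((Δᶜ \ R.nullExtinct q r η).card * r / (q * R.maxDecay q r η)) ≤
          ∑ σ ∈ R.nullExtinct q r η, x T σ ∧
        ∑ σ ∈ R.nullExtinct q r η, x T σ ≤
          (∑ σ ∈ R.nullExtinct q r η, x 0 σ) *
            Real.exp (-((Δᶜ \ R.nullExtinct q r η).card * r / R.maxDecay q r η))) ∧
    -- the stability depends only on the surviving opinions and on the skeleton
    (∀ (R' : ConfidenceRule ι) (q' r' : ℕ) (η' : ι → ℝ), 2 ≤ q' → 1 ≤ r' →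
      R'.IsFixedPoint q' r' η' → R'.skeleton = R.skeleton → survivors η' = survivors η →
        R'.unstableDirections q' r' η' = R.unstableDirections q r η ∧
        R'.stableDirections q' r' η' = R.stableDirections q r η ∧
        R'.noMovementDirections q' r' η' = R.noMovementDirections q r η ∧
        R'.neutralDirections q' r' η' = R.neutralDirections q r η) := by
  have unst := hη.unstableDirections_add hq hr
  have stab := hη.stableDirections_eq hq hr
  have nomo := hη.noMovementDirections_add_one hq hr
  have neut := hη.neutralDirections_eq hq hr
  subst hΔ hpred hsucc hk
  refine ⟨by lia, stab, by lia, by rw [neut], fun σ hσ => ?_,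
    ConfidenceRule.exists_nhds_nullExtinct_bounds_maxDecay hη.1 hq hr, ?_⟩
  · rw [neut] at hσ
    simp only [Finset.mem_inter, Finset.mem_sdiff, Finset.mem_compl] at hσ
    exact ConfidenceRule.hasMovementAlong_iff hη.1 hq hr hσ.1.1 hσ.1.2 hσ.2.2
  · intro R' q' r' η' hq' hr' hη' hskel hsurv
    have unst' := hη'.unstableDirections_add hq' hr'
    have stab' := hη'.stableDirections_eq hq' hr'
    have nomo' := hη'.noMovementDirections_add_one hq' hr'
    have neut' := hη'.neutralDirections_eq hq' hr'
    rw [hskel, hsurv] at unst' stab' nomo' neut'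
    exact ⟨by lia, stab'.trans stab.symm, by lia, neut'.trans neut.symm⟩
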